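/- **Setting.** Let $(I,\mathcal T)$ be a locally finite tree with root $r$ in which every branch $[i,\infty)=\{j: i\preceq j\}$ is infinite, where $i\preceq j$ means that $i$ lies on the geodesic from $r$ to $j$, and $|i|$ is the distance from $r$ to $i$. Let $w:\mathbb N\to(0,\infty)$ be strictly increasing, $w_{-1}=0$, $\Delta_k=w_k-w_{k-1}$ for $k\ge 0$. Let $X$ be the minimal continuous-time Markov chain on $I\cup\{\partial_r\}$, with $\partial_r$ absorbing, that jumps across the edge between $i\ne r$ and its predecessor $i^-$ at rate $\Delta_{|i|}^{-1}$ in both directions and from $r$ to $\partial_r$ at rate $w_0^{-1}$. Assume that it is transient: $\mathbb P_r\{T_{\partial_r}<\infty\}<1$. Let $\partial_\infty$ be the boundary of the tree (a point $\xi$ is identified with the infinite geodesic $(\xi(n))_{n\ge0}$ from $r=\xi(0)$), with its Borel $\sigma$-field, generated by the sets $C_j=\partial_\infty(j)=\{\xi: j=\xi(n)\text{ for some }n\}$, $j\in I$. Put $C^k(\xi)=C_{\xi(k)}$ and let $\mathcal F_k$ be the $\sigma$-field generated by the sets $C^k(\xi)$. Let $\mu=\mathbb P_r\{X_\zeta\in\cdot\mid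 X_\zeta\in\partial_\infty\}$ be the exit measure, where $X_\zeta$ is the limit of $X$ at its lifetime. For $\xi\neq\eta$ in $\partial_\infty$ let $U_{\xi\eta}=w_{|\xi\wedge\eta|}$, where $|\xi\wedge\eta|=\max\{n:\xi(n)=\eta(n)\}$, and let $U_{\xi\xi}=\lim_n w_n\in(0,\infty]$. Let $Wf(\eta)=\int U_{\eta\xi}f(\xi)\,\mu(d\xi)$ on $L^2(\mu)$, let $\mathcal D=\bigcup_n L^2(\mathcal F_n,\mu)$ be the set of simple functions, and put $$G_n(\eta)=\sum_{k\ge n}\Delta_k\,\mu(C^k(\eta)).$$ **Proposition.** $\mu$ is a probability measure; $\mu$-a.e. all the $G_n$ are positive, and $G_0$ is $\mu$-a.e. equal to the positive constant $w_0/\mathbb P_r\{X_\zeta\in\partial_\infty\}$. The operator $W$ is one-to-one on $L^2(\mu)$ and its range contains $\mathcal D$. Let $$\mathbf E(f,g)=\int_{\partial_\infty} g\,W^{-1}f\,d\mu ,\qquad H=\sum_{n\ge 0}\ \sum_{j\in I,\,|j|=n}\frac1{\mu(C_j)}\Big(\frac1{G_{n+1}}-\frac1{G_n}\Big)\mathbf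 1_{C_j\times C_j},$$ where in $H(\eta,\xi)$ the functions $G_n$, $G_{n+1}$ are evaluated at $\eta$, and let $D=\{(\eta,\eta):\eta\in\partial_\infty\}$. For $\mu\otimes\mu$-almost every $(\eta,\xi)\notin D$ one has $H(\eta,\xi)=H(\xi,\eta)\ge0$, and for all $f,g\in\mathcal D$ $$\mathbf E(f,g)=\frac12\int_{\partial_\infty\times\partial_\infty\setminus D}(f(\eta)-f(\xi))(g(\eta)-g(\xi))\,H(\eta,\xi)\,\mu\otimes\mu(d\eta,d\xi)+\frac1{G_0}\int_{\partial_\infty}f\,g\,d\mu ,$$ the first integrand being integrable. Thus the form consists of a pure jump part and a killing part, with no diffusive part. -/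

import Mathlib

open MeasureTheory ProbabilityTheory Set Filter Topology
open scoped ENNReal

/-- A tree matrix on an infinite rooted tree: a locally finite tree on the set of sites `I` with a
root, all of whose branches `[i, ∞)` are infinite, and a strictly positive, strictly increasing
weight function `w`. The tree matrix itself is `U i j = w |i ∧ j|`. -/
structure TreeMatrix (I : Type*) where
  graph : SimpleGraph I
  isTree : graph.IsTree
  locallyFinite : ∀ i, (graph.neighborSet i).Finite
  root : I
  infinite_branch : ∀ i,
    {j | graph.dist root i + graph.dist i j = graph.dist root j}.Infinite
  w : ℕ → ℝ
  w_pos : ∀ n, 0 < w n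
  w_strictMono : StrictMono w

namespace TreeMatrix

variable {I : Type*} (T : TreeMatrix I)

noncomputable section

/-- The level `|i|` of a site. -/
def level (i : I) : ℕ := T.graph.dist T.root i

/-- `i ⪯ j`: the site `i` lies on the geodesic from the root to `j`. -/
def Prec (i j : I) : Prop := T.graph.dist T.root i + T.graph.dist i j = T.graph.dist T.root j

/-- The increments `Δ_k = w_k - w_{k-1}`, with `w_{-1} = 0`. -/
def delta : ℕ → ℝ
  | 0 => T.w 0
  | k + 1 => T.w (k + 1) - T.w k

lemma delta_pos (k : ℕ) : 0 < T.delta k := by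
  cases k with
  | zero => exact T.w_pos 0
  | succ k => exact sub_pos.2 (T.w_strictMono (Nat.lt_succ_self k))

/-! ### The Markov chain on the sites -/

/-- The sites together with the absorbing state `∂_r`, written `none`. -/
def State (I : Type*) : Type _ := Option I

instance : MeasurableSpace (State I) := ⊤

open Classical in
/-- The off-diagonal part of the `q`-matrix `Q` of the tree matrix, extended to `∂_r`: the rate
across the edge between a site `i` and its predecessor `i⁻` is `(w_{|i|} - w_{|i|-1})⁻¹`, in both
directions, the root jumps to `∂_r` at rate `w_0⁻¹`, and `∂_r` is absorbing. -/
def rate : Option I → Option I → ℝ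
  | some i, some j =>
      if T.graph.Adj i j then (T.delta (max (T.level i) (T.level j)))⁻¹ else 0
  | some i, none => if i = T.root then (T.delta 0)⁻¹ else 0
  | none, _ => 0

lemma tsum_rate_ne_zero (i : I) :
    ∑' y : Option I, ENNReal.ofReal (T.rate (some i) y) ≠ 0 := by
  intro h
  rw [ENNReal.tsum_eq_zero] at h
  by_cases hi : i = T.root
  · have h1 := h none
    simp only [rate, hi, if_true, ENNReal.ofReal_eq_zero] at h1
    exact absurd (inv_pos.2 (T.delta_pos 0)) (not_lt.2 h1)
  · have : Nontrivial I := ⟨i, T.root, hi⟩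
    obtain ⟨j, hj⟩ := T.isTree.connected.preconnected.exists_adj_of_nontrivial i
    have h1 := h (some j)
    simp only [rate, hj, if_true, ENNReal.ofReal_eq_zero] at h1
    exact absurd (inv_pos.2 (T.delta_pos _)) (not_lt.2 h1)

lemma tsum_rate_ne_top (i : I) :
    ∑' y : Option I, ENNReal.ofReal (T.rate (some i) y) ≠ ∞ := by
  have hfin : (insert none (some '' T.graph.neighborSet i) : Set (Option I)).Finite :=
    ((T.locallyFinite i).image _).insert _
  rw [tsum_eq_sum (s := hfin.toFinset)]
  · exact ENNReal.sum_ne_top.2 fun _ _ => ENNReal.ofReal_ne_top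
  · intro y hy
    cases y with
    | none => simp at hy
    | some j =>
      have hj : ¬ T.graph.Adj i j := by
        intro hadj
        exact hy (by simpa using hadj)
      simp [rate, hj]

/-- One step of the jump chain of the `q`-matrix: `p_{ij}` is the rate from `i` to `j` divided by
the total rate out of `i`, and `∂_r` is absorbing. -/
def step : State I → PMF (State I)
  | none => PMF.pure (none : Option I)
  | some i => PMF.normalize (fun y : Option I => ENNReal.ofReal (T.rate (some i) y))
      (T.tsum_rate_ne_zero i) (T.tsum_rate_ne_top i)

/-- The transition kernel of the jump chain. -/
def stepKernel : Kernel (State I) (State I) where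
  toFun y := (T.step y).toMeasure
  measurable' := measurable_from_top

instance : IsMarkovKernel T.stepKernel :=
  ⟨fun y => PMF.toMeasure.isProbabilityMeasure (T.step y)⟩

/-- The transition kernel of the jump chain at time `n`, as a function of the whole past. -/
def pastKernel (n : ℕ) : Kernel ((k : Finset.Iic n) → State I) (State I) :=
  T.stepKernel.comap (fun x => x ⟨n, Finset.mem_Iic.2 le_rfl⟩) (measurable_pi_apply _)

instance (n : ℕ) : IsMarkovKernel (T.pastKernel n) :=
  inferInstanceAs (IsMarkovKernel (T.stepKernel.comap _ _))

/-- The law on path space of the jump chain started at the site `i`. -/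
def pathLaw (i : I) : Measure (ℕ → State I) :=
  Kernel.traj (X := fun _ => State I) T.pastKernel 0 (fun _ => (some i : Option I))

/-- `ℙ_r {T_{∂_r} < ∞} < 1`. -/
def Transient : Prop := T.pathLaw T.root {ω | ∃ k, ω k = (none : Option I)} < 1

/-! ### The boundary and the exit measure -/

/-- The boundary `∂_∞` of the tree. Every class of infinite chains contains exactly one chain that
starts at the root, and it stands for the class: `ξ n` is the site of level `n` on the geodesic
from the root to `ξ`. -/
def Boundary : Type _ :=
  {ξ : ℕ → I // ξ 0 = T.root ∧ (∀ n, T.graph.Adj (ξ n) (ξ (n + 1))) ∧ Function.Injective ξ}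

instance : CoeFun T.Boundary (fun _ => ℕ → I) := ⟨fun ξ => ξ.1⟩

/-- `∂_∞(i) = {η ∈ ∂_∞ : i ⪯ η}`. -/
def cyl (i : I) : Set T.Boundary := {η | i ∈ Set.range (η : ℕ → I)}

/-- `C^k(ξ) = ∂_∞(ξ(k))`. -/
def C (k : ℕ) (ξ : T.Boundary) : Set T.Boundary := T.cyl (ξ k)

/-- The Borel `σ`-field of the boundary, generated by the sets `∂_∞(i)`. -/
instance : MeasurableSpace T.Boundary := MeasurableSpace.generateFrom (Set.range T.cyl)

/-- The `σ`-field `ℱ_k` generated by the sets `C^k(ξ)`. -/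
@[reducible] def F (k : ℕ) : MeasurableSpace T.Boundary := MeasurableSpace.generateFrom (Set.range (T.C k))

/-- The path `ω` converges to the boundary point `ξ` in `I ∪ ∂_∞`: it eventually stays in each of
the neighbourhoods `[ξ(n), ∞]` of `ξ`. -/
def ConvergesTo (ω : ℕ → State I) (ξ : T.Boundary) : Prop :=
  ∀ n, ∀ᶠ k in atTop, ∃ j : I, ω k = (some j : Option I) ∧ T.Prec (ξ n) j

/-- The event `{X_ζ ∈ ∂_∞}`. The limit `X_ζ` of the minimal continuous-time chain at its lifetime
is the limit of its jump chain. -/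
def exitEvent : Set (ℕ → State I) := {ω | ∃ ξ, T.ConvergesTo ω ξ}

/-- `X_ζ` on the event `{X_ζ ∈ ∂_∞}`. -/
def exitPoint (ω : T.exitEvent) : T.Boundary := Classical.choose ω.2

/-- The exit probability `ℙ_r {X_ζ ∈ ∂_∞}`. -/
def exitProb : ℝ≥0∞ := T.pathLaw T.root T.exitEvent

/-- The exit measure `μ(A) = ℙ_r {X_ζ ∈ A | X_ζ ∈ ∂_∞}`. -/
def exitMeasure : Measure T.Boundary :=
  T.exitProb⁻¹ • ((T.pathLaw T.root).comap ((↑) : T.exitEvent → ℕ → State I)).map T.exitPoint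

/-! ### The operator `W`, its inverse and the Dirichlet form -/

/-- The level `|ξ ∧ η|` of the last common site of two distinct boundary points. -/
def meetLevel (ξ η : T.Boundary) : ℕ := sSup {n | ξ n = η n}

open Classical in
/-- The tree matrix on the boundary: `U ξ η = w_{|ξ ∧ η|}` if `ξ ≠ η`, and `U ξ ξ` is the limit of
the increasing sequence `w`, possibly infinite. -/
def U (ξ η : T.Boundary) : ℝ≥0∞ :=
  if ξ = η then ⨆ n, ENNReal.ofReal (T.w n) else ENNReal.ofReal (T.w (T.meetLevel ξ η))

/-- The space `L²(μ)`. -/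
abbrev L2 : Type _ := Lp ℝ 2 T.exitMeasure

/-- `W h = f` in `L²(μ)`, where `W h (η) = ∫ U η ξ h(ξ) μ(dξ)`; this includes that the integral
converges absolutely for almost every `η`. -/
def WEq (h f : T.L2) : Prop :=
  ∀ᵐ η ∂T.exitMeasure,
    ∫⁻ ξ, T.U η ξ * ‖h ξ‖ₑ ∂T.exitMeasure < ∞ ∧
    ∫ ξ, (T.U η ξ).toReal * h ξ ∂T.exitMeasure = f η

open Classical in
/-- `W⁻¹ f`, the element `h` of `L²(μ)` with `W h = f` (and `0` outside the range of `W`). -/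
def WInv (f : T.L2) : T.L2 := if h : ∃ h, T.WEq h f then h.choose else 0

/-- The Dirichlet form `E(f, g) = ∫ g W⁻¹ f dμ`. -/
def dirichletForm (f g : T.L2) : ℝ := ∫ η, g η * T.WInv f η ∂T.exitMeasure

/-- The set `𝒟 = ⋃ₙ L²(ℱ_n, μ)` of simple functions. -/
def simpleFunctions : Set T.L2 := {f | ∃ n, f ∈ lpMeas ℝ ℝ (T.F n) 2 T.exitMeasure}

/-- `G_n(η) = ∑_{k ≥ n} Δ_k μ(C^k(η))`. -/
def G (n : ℕ) (η : T.Boundary) : ℝ :=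
  ∑' k : ℕ, T.delta (n + k) * T.exitMeasure.real (T.C (n + k) η)

/-- The jump density
`H = ∑_{n ≥ 0} ∑_{|j| = n} μ(C_j)⁻¹ (1 / G_{n+1} - 1 / G_n) 1_{C_j × C_j}`, with `C_j = ∂_∞(j)`;
the functions `G_n` and `G_{n+1}` are evaluated at the first variable. -/
def H (η ξ : T.Boundary) : ℝ :=
  ∑' n : ℕ, ∑' j : {j : I // T.level j = n},
    (1 / T.exitMeasure.real (T.cyl j)) * (1 / T.G (n + 1) η - 1 / T.G n η) *
      (T.cyl (j : I) ×ˢ T.cyl (j : I)).indicator (fun _ => (1 : ℝ)) (η, ξ)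

/-- The constant `α = w_0 / ℙ_r {X_ζ ∈ ∂_∞}`. -/
def alpha : ℝ := T.w 0 / T.exitProb.toReal

end

end TreeMatrix

/-! Everything is governed by the probability $h(x)$ that the chain started at $x$ hits $\partial_r$
(`hit`), with $h(\partial_r)=1$. Since $\partial_r$ is entered only from the root, $h$ is
proportional to the Green function at the root, and by reversibility the expected number of visits
to $i$ from $r$ is $w_0h(i)$ times the total rate out of $i$ (`tendsto_sum_prob_eval`). To end in
the branch of $j\ne r$, the chain must jump from $j^-$ to $j$ one last time and then stay there;
staying has probability $1-h(j)/h(j^-)$, because every way from $j$ to $\partial_r$ passes through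
$j^-$. Summation over the visits to $j^-$ gives $\Delta_{|j|}\mu(C_j)=\alpha(h(j^-)-h(j))$
(`delta_mul_exitMeasure_cyl`), where $\alpha=w_0/\mathbb P_r\{X_\zeta\in\partial_\infty\}$. The
bounded martingale $h(X_n)$ tends to the indicator of absorption, so $h(\xi(n))\to0$ for $\mu$-a.e.
$\xi$, and the series $G_n$ telescopes to $\alpha h(\eta(n-1))$. In particular $G_0=\alpha$, and
$G_n$ is predictable: it depends only on $\eta(n-1)$.

On the boundary $U=\sum_k\Delta_k\mathbf 1_{C^k}$ (`U_eq_tsum`). With $E_k$ the conditional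
expectation given $\mathcal F_k$ and $E_{-1}=0$, this reads
$W=\sum_k(G_k-G_{k+1})E_k=\sum_kG_k(E_k-E_{k-1})$. By predictability
$W^{-1}=\sum_kG_k^{-1}(E_k-E_{k-1})$ on simple functions, and summation by parts turns this into
$G_0^{-1}+\sum_k(G_{k+1}^{-1}-G_k^{-1})(1-E_k)$ (`Transient.integral_U_preimageW`). The operator
$1-E_k$ averages the differences $f(\eta)-f(\xi)$ over $\xi\in C^k(\eta)$, so symmetrization yields
the jump kernel $H$, and $G_0^{-1}$ is the killing (`Transient.beurlingDeny`). For simple functions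
all sums over $k$ are finite.

Injectivity follows from the symmetry of $U$: each $\mathbf 1_{C_j}$ is $Wg$ with $g$ bounded, so
$Wd=0$ forces $\int_{C_j}d\,d\mu=0$ for every $j$ (`Transient.wEq_unique`). -/

namespace TreeMatrix

variable {I : Type*} (T : TreeMatrix I)

noncomputable section

/-! ### Predecessors -/

lemma level_adj {i j : I} (h : T.graph.Adj i j) :
    T.level i = T.level j + 1 ∨ T.level j = T.level i + 1 :=
  T.isTree.dist_eq_dist_add_one_of_adj T.root h

lemma level_root : T.level T.root = 0 := by simp [level]

lemma level_eq_zero {i : I} : T.level i = 0 ↔ i = T.root := by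
  rw [level, T.isTree.connected.dist_eq_zero_iff, eq_comm]

/-- Geodesics to $p$ and $q$, each prolonged by the edge to $i$, are two paths from the root to $i$.
In a tree they coincide, and so do their penultimate sites. -/
lemma eq_of_adj_of_level {i p q : I} (hp : T.graph.Adj p i) (hq : T.graph.Adj q i)
    (hp' : T.level i = T.level p + 1) (hq' : T.level i = T.level q + 1) : p = q := by
  obtain ⟨a, ha⟩ := T.isTree.connected.exists_walk_length_eq_dist T.root p
  obtain ⟨b, hb⟩ := T.isTree.connected.exists_walk_length_eq_dist T.root q
  have h1 : (a.concat hp).IsPath := by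
    apply SimpleGraph.Walk.isPath_of_length_eq_dist
    rw [SimpleGraph.Walk.length_concat, ha]; exact hp'.symm
  have h2 : (b.concat hq).IsPath := by
    apply SimpleGraph.Walk.isPath_of_length_eq_dist
    rw [SimpleGraph.Walk.length_concat, hb]; exact hq'.symm
  have h3 := (T.isTree.existsUnique_path T.root i).unique h1 h2
  have h4 := congrArg SimpleGraph.Walk.penultimate h3
  simpa using h4

lemma exists_adj_dist {i j : I} (h : i ≠ j) :
    ∃ k, T.graph.Adj k j ∧ T.graph.dist i j = T.graph.dist i k + 1 := by
  obtain ⟨a, ha⟩ := T.isTree.connected.exists_walk_length_eq_dist j i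
  cases a with
  | nil => exact absurd rfl h
  | @cons _ k _ hk q =>
    refine ⟨k, hk.symm, ?_⟩
    have h1 := SimpleGraph.dist_le q
    have h2 := hk.diff_dist_adj (u := i)
    rw [SimpleGraph.Walk.length_cons] at ha
    rw [SimpleGraph.dist_comm] at h1 ha
    omega

lemma exists_adj_level {i : I} (h : i ≠ T.root) :
    ∃ p, T.graph.Adj p i ∧ T.level i = T.level p + 1 :=
  T.exists_adj_dist h.symm

open Classical in
/-- The predecessor of a site; the predecessor of the root is `∂_r`. -/
def pred (i : I) : Option I := if h : i = T.root then none else some (T.exists_adj_level h).choose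

lemma pred_eq_none_iff {i : I} : T.pred i = none ↔ i = T.root := by
  unfold pred; split <;> simp [*]

lemma pred_root : T.pred T.root = none := T.pred_eq_none_iff.2 rfl

lemma pred_eq_some_iff {i j : I} :
    T.pred j = some i ↔ T.graph.Adj i j ∧ T.level j = T.level i + 1 := by
  unfold pred
  split
  · next h =>
    simp only [reduceCtorEq, false_iff, not_and]
    intro _ h1
    rw [h, level_root] at h1
    omega
  · next h =>
    have hs := (T.exists_adj_level h).choose_spec
    rw [Option.some_inj]
    exact ⟨fun e => e ▸ hs, fun e => T.eq_of_adj_of_level hs.1 e.1 hs.2 e.2⟩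

lemma level_of_pred {i j : I} (h : T.pred j = some i) : T.level j = T.level i + 1 :=
  (T.pred_eq_some_iff.1 h).2

lemma adj_iff {i j : I} : T.graph.Adj i j ↔ T.pred i = some j ∨ T.pred j = some i := by
  simp only [pred_eq_some_iff]
  constructor
  · intro h
    rcases T.level_adj h with h1 | h1
    · exact .inl ⟨h.symm, h1⟩
    · exact .inr ⟨h, h1⟩
  · rintro (h | h)
    · exact h.1.symm
    · exact h.1

lemma pred_induction {P : I → Prop} (h : ∀ i, (∀ p, T.pred i = some p → P p) → P i) (i : I) :
    P i := by
  induction hn : T.level i generalizing i with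
  | zero =>
    refine h i fun p hp => ?_
    have := T.level_of_pred hp
    omega
  | succ n ih =>
    refine h i fun p hp => ih p ?_
    have := T.level_of_pred hp
    omega

/-- The recursive description of the order along predecessors. It replaces distances in most of what
follows and makes `pred_induction` applicable. -/
lemma prec_iff {i j : I} : T.Prec i j ↔ i = j ∨ ∃ p, T.pred j = some p ∧ T.Prec i p := by
  constructor
  · intro h
    by_cases hij : i = j
    · exact .inl hij
    obtain ⟨k, hk, hd⟩ := T.exists_adj_dist hij
    have ht := T.isTree.connected.dist_triangle (u := T.root) (v := i) (w := k)
    have hl := T.level_adj hk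
    unfold Prec at h ⊢
    unfold level at hl
    refine .inr ⟨k, T.pred_eq_some_iff.2 ⟨hk, ?_⟩, ?_⟩
    · unfold level; omega
    · omega
  · rintro (rfl | ⟨p, hp, h⟩)
    · simp [Prec]
    · obtain ⟨ha, hl⟩ := T.pred_eq_some_iff.1 hp
      have ht := T.isTree.connected.dist_triangle (u := T.root) (v := i) (w := j)
      have ht' := ha.diff_dist_adj (u := i)
      unfold Prec at h ⊢
      unfold level at hl
      omega

lemma prec_refl (i : I) : T.Prec i i := T.prec_iff.2 (.inl rfl)

lemma prec_of_pred {i p j : I} (hp : T.pred j = some p) (h : T.Prec i p) : T.Prec i j :=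
  T.prec_iff.2 (.inr ⟨p, hp, h⟩)

variable {T} in
lemma Prec.level_le {i j : I} (h : T.Prec i j) : T.level i ≤ T.level j := by
  unfold Prec at h; unfold level; omega

variable {T} in
lemma Prec.trans {i j k : I} (h : T.Prec i j) (h' : T.Prec j k) : T.Prec i k := by
  have h1 := T.isTree.connected.dist_triangle (u := i) (v := j) (w := k)
  have h2 := T.isTree.connected.dist_triangle (u := T.root) (v := i) (w := k)
  unfold Prec at *
  omega

variable {T} in
lemma Prec.eq_of_level_le {i j : I} (h : T.Prec i j) (hl : T.level j ≤ T.level i) : i = j := by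
  rw [← T.isTree.connected.dist_eq_zero_iff]
  unfold Prec at h; unfold level at hl; omega

variable {T} in
lemma Prec.of_pred {i p j : I} (hp : T.pred j = some p) (h : T.Prec i j) (hne : i ≠ j) :
    T.Prec i p := by
  rcases T.prec_iff.1 h with h | ⟨q, hq, h⟩
  · exact absurd h hne
  · rw [hp, Option.some_inj] at hq; exact hq ▸ h

lemma prec_unique {i i' j : I} (h : T.Prec i j) (h' : T.Prec i' j) (hl : T.level i = T.level i') :
    i = i' := by
  induction j using T.pred_induction with
  | h j ih =>
    by_cases hi : i = j
    · subst hi; exact (h'.eq_of_level_le hl.le).symm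
    by_cases hi' : i' = j
    · subst hi'; exact h.eq_of_level_le hl.ge
    rcases T.prec_iff.1 h with h1 | ⟨q, hq, h1⟩
    · exact absurd h1 hi
    · exact ih q hq h1 (h'.of_pred hq hi')

lemma exists_prec_level {j : I} {n : ℕ} (hn : n ≤ T.level j) :
    ∃ i, T.level i = n ∧ T.Prec i j := by
  induction j using T.pred_induction with
  | h j ih =>
    by_cases hj : n = T.level j
    · exact ⟨j, hj.symm, T.prec_refl j⟩
    cases hp : T.pred j with
    | none =>
      rw [T.pred_eq_none_iff] at hp
      have h0 := T.level_eq_zero.2 hp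
      omega
    | some p =>
      obtain ⟨i, hi, h⟩ := ih p hp (by have := T.level_of_pred hp; omega)
      exact ⟨i, hi, T.prec_of_pred hp h⟩

lemma finite_level (n : ℕ) : {i | T.level i = n}.Finite := by
  induction n with
  | zero =>
    refine (Set.finite_singleton T.root).subset fun i hi => ?_
    exact T.level_eq_zero.1 hi
  | succ n ih =>
    refine (ih.biUnion fun i _ => T.locallyFinite i).subset fun i hi => ?_
    have hr : i ≠ T.root := by
      rintro rfl; simp [level_root] at hi
    obtain ⟨p, hp, hl⟩ := T.exists_adj_level hr
    simp only [mem_iUnion, mem_ofPred_eq] at hi ⊢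
    exact ⟨p, by omega, hp⟩

lemma finite_level_le (n : ℕ) : {i | T.level i ≤ n}.Finite := by
  refine ((Set.finite_Iic n).biUnion fun k _ => T.finite_level k).subset fun i hi => ?_
  simpa using hi

lemma countable_sites (T : TreeMatrix I) : Countable I := by
  rw [← Set.countable_univ_iff]
  refine (Set.countable_iUnion fun n => (T.finite_level n).countable).mono fun i _ => ?_
  simp

/-! ### Boundary points -/

variable {T}

lemma Boundary.level_pred (ξ : T.Boundary) (n : ℕ) :
    T.level (ξ n) = n ∧ T.pred (ξ (n + 1)) = some (ξ n) := by
  induction n with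
  | zero =>
    have h0 : T.level (ξ 0) = 0 := by rw [ξ.2.1, level_root]
    refine ⟨h0, ?_⟩
    rcases T.adj_iff.1 (ξ.2.2.1 0) with h | h
    · rw [ξ.2.1, pred_root] at h; simp at h
    · exact h
  | succ n ih =>
    have h1 := T.level_of_pred ih.2
    refine ⟨by omega, ?_⟩
    rcases T.adj_iff.1 (ξ.2.2.1 (n + 1)) with h | h
    · rw [ih.2, Option.some_inj] at h
      have := ξ.2.2.2 h
      omega
    · exact h

lemma Boundary.level (ξ : T.Boundary) (n : ℕ) : T.level (ξ n) = n := (ξ.level_pred n).1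

lemma Boundary.pred (ξ : T.Boundary) (n : ℕ) : T.pred (ξ (n + 1)) = some (ξ n) :=
  (ξ.level_pred n).2

lemma Boundary.prec (ξ : T.Boundary) {n m : ℕ} (h : n ≤ m) : T.Prec (ξ n) (ξ m) := by
  induction m, h using Nat.le_induction with
  | base => exact T.prec_refl _
  | succ m _ ih => exact T.prec_of_pred (ξ.pred m) ih

lemma Boundary.eq_of_le {ξ η : T.Boundary} {n m : ℕ} (h : n ≤ m) (e : ξ m = η m) : ξ n = η n := by
  refine T.prec_unique (j := ξ m) (ξ.prec h) ?_ (by rw [ξ.level, η.level])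
  rw [e]; exact η.prec h

lemma Boundary.ext {ξ η : T.Boundary} (h : ∀ n, ξ n = η n) : ξ = η := Subtype.ext (funext h)

lemma mem_cyl {ξ : T.Boundary} {i : I} : ξ ∈ T.cyl i ↔ ξ (T.level i) = i := by
  constructor
  · rintro ⟨n, rfl⟩; rw [ξ.level]
  · exact fun h => ⟨_, h⟩

lemma mem_C {ξ η : T.Boundary} {n : ℕ} : η ∈ T.C n ξ ↔ η n = ξ n := by
  rw [C, mem_cyl, ξ.level]

lemma measurableSet_cyl (i : I) : MeasurableSet (T.cyl i) :=
  MeasurableSpace.measurableSet_generateFrom ⟨i, rfl⟩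

lemma C_eq {ξ η : T.Boundary} {n : ℕ} (h : η n = ξ n) : T.C n ξ = T.C n η := by
  unfold C; rw [h]

/-- The chain of sites `i n` with `i n` of level `n` and `i n` below `i (n + 1)` is a boundary
point. -/
lemma exists_boundary {i : ℕ → I} (h : ∀ n, T.level (i n) = n)
    (h' : ∀ n, T.pred (i (n + 1)) = some (i n)) : ∃ ξ : T.Boundary, ∀ n, ξ n = i n := by
  refine ⟨⟨i, T.level_eq_zero.1 (h 0), fun n => T.adj_iff.2 (.inr (h' n)), fun n m e => ?_⟩,
    fun n => rfl⟩
  rw [← h n, ← h m, e]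

/-! ### Rates -/

variable (T)

lemma rate_pred (i : I) : T.rate (some i) (T.pred i) = (T.delta (T.level i))⁻¹ := by
  cases hp : T.pred i with
  | none =>
    rw [pred_eq_none_iff] at hp
    simp [rate, hp, level_root]
  | some p =>
    have h1 := T.level_of_pred hp
    have h2 : T.graph.Adj i p := T.adj_iff.2 (.inl hp)
    simp [rate, h2, h1]

lemma rate_of_pred {i c : I} (h : T.pred c = some i) :
    T.rate (some i) (some c) = (T.delta (T.level c))⁻¹ := by
  have h1 := T.level_of_pred h
  have h2 : T.graph.Adj i c := T.adj_iff.2 (.inr h)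
  simp [rate, h2, h1]

lemma rate_ne_zero {i : I} {y : Option I} (h : T.rate (some i) y ≠ 0) :
    y = T.pred i ∨ ∃ c, y = some c ∧ T.pred c = some i := by
  cases y with
  | none =>
    simp only [rate] at h
    left
    by_contra h1
    rw [if_neg] at h
    · exact h rfl
    · exact fun e => h1 (T.pred_eq_none_iff.2 e).symm
  | some j =>
    simp only [rate] at h
    have hj : T.graph.Adj i j := by
      by_contra hj
      simp [hj] at h
    rcases T.adj_iff.1 hj with h1 | h1
    · exact .inl h1.symm
    · exact .inr ⟨j, rfl, h1⟩

lemma rate_nonneg (x y : Option I) : 0 ≤ T.rate x y := by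
  have h := fun k => (inv_pos.2 (T.delta_pos k)).le
  cases x <;> cases y <;> simp only [rate, le_refl] <;> split <;> simp [h]

lemma rate_symm (i j : I) : T.rate (some i) (some j) = T.rate (some j) (some i) := by
  rw [rate, rate, max_comm, T.graph.adj_comm]

lemma finite_rate (i : I) : {y | T.rate (some i) y ≠ 0}.Finite := by
  refine (((T.locallyFinite i).image some).insert none).subset fun y hy => ?_
  cases y with
  | none => simp
  | some j =>
    have hj : T.graph.Adj i j := by
      by_contra hj
      simp [rate, hj] at hy
    simp [hj]

/-- The states that can be reached from a site by one jump. -/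
def nbr (i : I) : Finset (Option I) := (T.finite_rate i).toFinset

lemma mem_nbr {i : I} {y : Option I} : y ∈ T.nbr i ↔ T.rate (some i) y ≠ 0 := by simp [nbr]

lemma rate_of_not_mem_nbr {i : I} {y : Option I} (h : y ∉ T.nbr i) : T.rate (some i) y = 0 := by
  simpa [mem_nbr] using h

lemma pred_mem_nbr (i : I) : T.pred i ∈ T.nbr i := by
  rw [mem_nbr, rate_pred]; exact (inv_pos.2 (T.delta_pos _)).ne'

lemma mem_nbr_of_pred {i c : I} (h : T.pred c = some i) : some c ∈ T.nbr i := by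
  rw [mem_nbr, T.rate_of_pred h]; exact (inv_pos.2 (T.delta_pos _)).ne'

lemma mem_nbr_iff {i : I} {y : Option I} :
    y ∈ T.nbr i ↔ y = T.pred i ∨ ∃ c, y = some c ∧ T.pred c = some i := by
  refine ⟨fun h => T.rate_ne_zero (T.mem_nbr.1 h), ?_⟩
  rintro (rfl | ⟨c, rfl, hc⟩)
  · exact T.pred_mem_nbr i
  · exact T.mem_nbr_of_pred hc

/-- The total rate out of a site. -/
def total (i : I) : ℝ := ∑ y ∈ T.nbr i, T.rate (some i) y

lemma total_pos (i : I) : 0 < T.total i := by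
  refine Finset.sum_pos' (fun y _ => T.rate_nonneg _ _) ⟨_, T.pred_mem_nbr i, ?_⟩
  rw [rate_pred]; exact inv_pos.2 (T.delta_pos _)

/-- The mean of `φ` after one step of the jump chain. -/
def avg (φ : Option I → ℝ) : Option I → ℝ
  | none => φ none
  | some i => (T.total i)⁻¹ * ∑ y ∈ T.nbr i, T.rate (some i) y * φ y

/-! ### The probability of hitting `∂_r` and the Green function at the root -/

@[simp] lemma avg_none (φ : Option I → ℝ) : T.avg φ none = φ none := rfl

lemma avg_mono {φ ψ : Option I → ℝ} (h : ∀ x, φ x ≤ ψ x) (x : Option I) :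
    T.avg φ x ≤ T.avg ψ x := by
  cases x with
  | none => exact h none
  | some i =>
    refine mul_le_mul_of_nonneg_left ?_ (inv_pos.2 (T.total_pos i)).le
    exact Finset.sum_le_sum fun y _ => mul_le_mul_of_nonneg_left (h y) (T.rate_nonneg _ _)

lemma avg_const (c : ℝ) (x : Option I) : T.avg (fun _ => c) x = c := by
  cases x with
  | none => rfl
  | some i =>
    simp only [avg]
    rw [← Finset.sum_mul, ← mul_assoc]
    change (T.total i)⁻¹ * T.total i * c = c
    rw [inv_mul_cancel₀ (T.total_pos i).ne', one_mul]

lemma avg_congr {φ ψ : Option I → ℝ} {i : I} (h : ∀ y ∈ T.nbr i, φ y = ψ y) :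
    T.avg φ (some i) = T.avg ψ (some i) := by
  simp only [avg]
  rw [Finset.sum_congr rfl fun y hy => by rw [h y hy]]

lemma avg_sub_mul (φ : Option I → ℝ) (a b : ℝ) (x : Option I) :
    T.avg (fun y => a - φ y * b) x = a - T.avg φ x * b := by
  cases x with
  | none => rfl
  | some i =>
    have h := T.avg_const a (some i)
    simp only [avg] at h ⊢
    simp only [mul_sub, Finset.sum_sub_distrib, h]
    simp only [← mul_assoc, ← Finset.sum_mul]

lemma avg_mul_sum (φ : ℕ → Option I → ℝ) (c : ℝ) (n : ℕ) (i : I) :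
    T.avg (fun y => c * ∑ m ∈ Finset.range n, φ m y) (some i)
      = c * ∑ m ∈ Finset.range n, T.avg (φ m) (some i) := by
  simp only [avg, Finset.mul_sum]
  rw [Finset.sum_comm]
  exact Finset.sum_congr rfl fun _ _ => Finset.sum_congr rfl fun _ _ => by ring

lemma tendsto_avg {φ : ℕ → Option I → ℝ} {ψ : Option I → ℝ}
    (h : ∀ x, Tendsto (fun n => φ n x) atTop (𝓝 (ψ x))) (x : Option I) :
    Tendsto (fun n => T.avg (φ n) x) atTop (𝓝 (T.avg ψ x)) := by
  cases x with
  | none => exact h none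
  | some i => exact (tendsto_finsetSum _ fun y _ => (h y).const_mul _).const_mul _

/-- The probability that the jump chain started at `x` is at `∂_r` at time `n`. -/
def hitBy : ℕ → Option I → ℝ
  | 0 => fun x => x.elim 1 fun _ => 0
  | n + 1 => T.avg (hitBy n)

@[simp] lemma hitBy_none (n : ℕ) : T.hitBy n none = 1 := by
  induction n with
  | zero => rfl
  | succ n ih => rw [hitBy, avg_none, ih]

lemma hitBy_nonneg (n : ℕ) (x : Option I) : 0 ≤ T.hitBy n x := by
  induction n generalizing x with
  | zero => cases x <;> simp [hitBy]
  | succ n ih => simpa [avg_const, hitBy] using T.avg_mono (φ := fun _ => 0) ih x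

lemma hitBy_le_one (n : ℕ) (x : Option I) : T.hitBy n x ≤ 1 := by
  induction n generalizing x with
  | zero => cases x <;> simp [hitBy]
  | succ n ih => simpa [avg_const, hitBy] using T.avg_mono (ψ := fun _ => 1) ih x

lemma hitBy_mono (x : Option I) : Monotone fun n => T.hitBy n x := by
  refine monotone_nat_of_le_succ fun n => ?_
  induction n generalizing x with
  | zero =>
    cases x with
    | none => simp
    | some i => exact T.hitBy_nonneg 1 _
  | succ n ih => exact T.avg_mono ih x

/-- The probability that the jump chain started at `x` hits `∂_r`. -/
def hit (x : Option I) : ℝ := ⨆ n, T.hitBy n x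

lemma tendsto_hitBy (x : Option I) : Tendsto (fun n => T.hitBy n x) atTop (𝓝 (T.hit x)) :=
  tendsto_atTop_ciSup (T.hitBy_mono x) ⟨1, by rintro _ ⟨n, rfl⟩; exact T.hitBy_le_one n x⟩

@[simp] lemma hit_none : T.hit none = 1 := by simp [hit]

lemma hitBy_le_hit (n : ℕ) (x : Option I) : T.hitBy n x ≤ T.hit x :=
  (T.hitBy_mono x).ge_of_tendsto (T.tendsto_hitBy x) n

lemma hit_nonneg (x : Option I) : 0 ≤ T.hit x :=
  ge_of_tendsto' (T.tendsto_hitBy x) fun n => T.hitBy_nonneg n x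

lemma hit_le_one (x : Option I) : T.hit x ≤ 1 :=
  le_of_tendsto' (T.tendsto_hitBy x) fun n => T.hitBy_le_one n x

lemma avg_hit (x : Option I) : T.avg T.hit x = T.hit x :=
  tendsto_nhds_unique (T.tendsto_avg T.tendsto_hitBy x)
    ((tendsto_add_atTop_iff_nat 1).2 (T.tendsto_hitBy x))

/-- The jump to the predecessor always has positive rate, so $\partial_r$ is reachable from every
site. This makes the quotients by $h(j^-)$ meaningful and the $G_n$ positive. -/
lemma hit_pos (x : Option I) : 0 < T.hit x := by
  cases x with
  | none => simp
  | some i =>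
    induction i using T.pred_induction with
    | h i ih =>
      have h1 : 0 < T.hit (T.pred i) := by
        cases hp : T.pred i with
        | none => simp
        | some p => exact ih p hp
      rw [← avg_hit]
      refine mul_pos (inv_pos.2 (T.total_pos i)) (Finset.sum_pos'
        (fun y _ => mul_nonneg (T.rate_nonneg _ _) (T.hit_nonneg _)) ⟨_, T.pred_mem_nbr i, ?_⟩)
      rw [rate_pred]
      exact mul_pos (inv_pos.2 (T.delta_pos _)) h1

open Classical in
/-- The probability that the jump chain started at `x` is at the root at time `n`. -/
def returnProb : ℕ → Option I → ℝ
  | 0 => fun x => if x = some T.root then 1 else 0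
  | n + 1 => T.avg (returnProb n)

@[simp] lemma returnProb_none (n : ℕ) : T.returnProb n none = 0 := by
  induction n with
  | zero => simp [returnProb]
  | succ n ih => rw [returnProb, avg_none, ih]

open Classical in
-- Absorption happens by a jump from the root, and each visit to the root ends in $\partial_r$ with
-- probability $w_0^{-1}$ divided by the total rate there.
lemma hitBy_eq_sum (n : ℕ) (i : I) :
    T.hitBy n (some i)
      = (T.total T.root * T.w 0)⁻¹ * ∑ m ∈ Finset.range n, T.returnProb m (some i) := by
  induction n generalizing i with
  | zero => simp [hitBy]
  | succ n ih =>
    -- The induction hypothesis covers the sites only. At $\partial_r$ the left side is 1 and the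
    -- Green sum is 0, which leaves the probability of immediate absorption; it matches the term
    -- $m=0$ of the new sum.
    have h1 : T.avg (T.hitBy n) (some i)
        = T.avg (fun y => (T.total T.root * T.w 0)⁻¹ * ∑ m ∈ Finset.range n, T.returnProb m y)
            (some i) + (T.total i)⁻¹ * T.rate (some i) none := by
      simp only [avg]
      rw [← mul_add]
      congr 1
      by_cases hi : none ∈ T.nbr i
      · rw [← Finset.add_sum_erase _ _ hi, ← Finset.add_sum_erase _ _ hi]
        simp only [hitBy_none, returnProb_none, Finset.sum_const_zero]
        rw [mul_zero, mul_zero, zero_add, mul_one, add_comm]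
        congr 1
        refine Finset.sum_congr rfl fun y hy => ?_
        cases y with
        | none => simp at hy
        | some j => rw [ih]
      · rw [T.rate_of_not_mem_nbr hi, add_zero]
        refine Finset.sum_congr rfl fun y hy => ?_
        cases y with
        | none => exact absurd hy hi
        | some j => rw [ih]
    rw [hitBy, h1, avg_mul_sum, Finset.sum_range_succ', mul_add]
    congr 1
    by_cases hi : i = T.root
    · subst hi
      simp [returnProb, rate, delta, mul_comm]
    · simp [returnProb, rate, hi]

/-- The Green function at the root is proportional to the probability of hitting `∂_r`. -/
lemma tendsto_sum_returnProb (i : I) :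
    Tendsto (fun n => ∑ m ∈ Finset.range n, T.returnProb m (some i)) atTop
      (𝓝 (T.total T.root * T.w 0 * T.hit (some i))) := by
  have hpos : T.total T.root * T.w 0 ≠ 0 := (mul_pos (T.total_pos _) (T.w_pos 0)).ne'
  refine ((T.tendsto_hitBy (some i)).const_mul (T.total T.root * T.w 0)).congr fun n => ?_
  rw [hitBy_eq_sum, mul_inv_cancel_left₀ hpos]

/-! ### The probability of staying in a branch -/

open Classical in
/-- The probability that the jump chain started at `x` stays in the branch `[j, ∞)` forever. -/
def stay (j : I) : Option I → ℝ
  | none => 0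
  | some x => if T.Prec j x then 1 - T.hit (some x) / T.hit (T.pred j) else 0

@[simp] lemma stay_none (j : I) : T.stay j none = 0 := rfl

lemma stay_of_prec {j x : I} (h : T.Prec j x) :
    T.stay j (some x) = 1 - T.hit (some x) / T.hit (T.pred j) := by simp [stay, h]

lemma stay_of_not_prec {j x : I} (h : ¬ T.Prec j x) : T.stay j (some x) = 0 := by simp [stay, h]

lemma stay_self (j : I) : T.stay j (some j) = 1 - T.hit (some j) / T.hit (T.pred j) :=
  T.stay_of_prec (T.prec_refl j)

lemma abs_stay_le (j : I) (x : Option I) : |T.stay j x| ≤ 1 + 1 / T.hit (T.pred j) := by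
  have hp := T.hit_pos (T.pred j)
  have h0 : 0 ≤ 1 / T.hit (T.pred j) := by positivity
  cases x with
  | none => simp only [stay_none, abs_zero]; linarith
  | some x =>
    by_cases h : T.Prec j x
    · rw [T.stay_of_prec h]
      have h1 : T.hit (some x) / T.hit (T.pred j) ≤ 1 / T.hit (T.pred j) :=
        div_le_div_of_nonneg_right (T.hit_le_one _) hp.le
      have h2 : 0 ≤ T.hit (some x) / T.hit (T.pred j) := div_nonneg (T.hit_nonneg _) hp.le
      rw [abs_le]; constructor <;> linarith
    · rw [T.stay_of_not_prec h, abs_zero]; linarith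

open Classical in
-- Harmonic except at $j^-$, the only site outside the branch from which it can be entered. From
-- inside, the branch can be left only to $j^-$, where the formula $1-h/h(j^-)$ gives the correct
-- value 0, so harmonicity of $h$ carries over.
lemma avg_stay (j x : I) : T.avg (T.stay j) (some x) = T.stay j (some x) +
    if T.pred j = some x then (T.total x)⁻¹ * T.rate (some x) (some j) * T.stay j (some j)
    else 0 := by
  by_cases h : T.Prec j x
  · have hne : T.pred j ≠ some x := by
      intro e
      have := T.level_of_pred e
      have := h.level_le
      omega
    rw [if_neg hne, add_zero, T.stay_of_prec h]
    have h1 : ∀ y ∈ T.nbr x, T.stay j y = 1 - T.hit y * (T.hit (T.pred j))⁻¹ := by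
      intro y hy
      rcases T.mem_nbr_iff.1 hy with rfl | ⟨c, rfl, hc⟩
      · by_cases hx : j = x
        · subst hx
          rw [mul_inv_cancel₀ (T.hit_pos _).ne', sub_self]
          cases hp : T.pred j with
          | none => rfl
          | some p =>
            refine T.stay_of_not_prec fun h' => ?_
            have := T.level_of_pred hp
            have := h'.level_le
            omega
        · cases hp : T.pred x with
          | none =>
            rcases T.prec_iff.1 h with e | ⟨p, hp', _⟩
            · exact absurd e hx
            · simp [hp] at hp'
          | some p => exact T.stay_of_prec (h.of_pred hp hx)
      · exact T.stay_of_prec (T.prec_of_pred hc h)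
    rw [T.avg_congr h1, avg_sub_mul, avg_hit, div_eq_mul_inv]
  · rw [T.stay_of_not_prec h, zero_add]
    have h1 : ∀ y ∈ T.nbr x, T.stay j y ≠ 0 → y = some j ∧ T.pred j = some x := by
      intro y hy hne
      cases y with
      | none => simp at hne
      | some c =>
        have hc : T.Prec j c := by
          by_contra hc; exact hne (T.stay_of_not_prec hc)
        rcases T.mem_nbr_iff.1 hy with h' | ⟨c', h', hp⟩
        · exact absurd (T.prec_of_pred h'.symm hc) h
        · rw [Option.some_inj] at h'
          subst h'
          have : j = c := by
            by_contra e; exact h (hc.of_pred hp e)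
          subst this
          exact ⟨rfl, hp⟩
    split
    · next hp =>
      simp only [avg]
      rw [Finset.sum_eq_single (some j), mul_assoc]
      · intro y hy hne
        by_contra h2
        exact hne (h1 y hy (right_ne_zero_of_mul h2)).1
      · exact fun hn => absurd (T.mem_nbr_of_pred hp) hn
    · next hp =>
      simp only [avg]
      rw [Finset.sum_eq_zero, mul_zero]
      intro y hy
      by_contra h2
      exact hp (h1 y hy (right_ne_zero_of_mul h2)).2

/-! ### One step of the jump chain -/

instance : MeasurableSpace (Option I) := ⊤

instance : MeasurableSingletonClass (Option I) := ⟨fun _ => trivial⟩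

instance : MeasurableSingletonClass (State I) := ⟨fun _ => trivial⟩

/-- A state of the chain, as a site or `none`. -/
def State.toOption (x : State I) : Option I := x

/-- A site or `none`, as a state of the chain. -/
def State.ofOption (x : Option I) : State I := x

/-- The position of the jump chain at time `n`. -/
def pos (n : ℕ) (ω : ℕ → State I) : Option I := (ω n).toOption

lemma measurable_pos (n : ℕ) : Measurable (pos n : (ℕ → State I) → Option I) :=
  (measurable_from_top (f := State.toOption)).comp (measurable_pi_apply n)

lemma step_apply_toReal (i : I) (y : Option I) :
    (T.step (.ofOption (some i)) (.ofOption y)).toReal = (T.total i)⁻¹ * T.rate (some i) y := by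
  have h1 : ∑' y : Option I, ENNReal.ofReal (T.rate (some i) y) = ENNReal.ofReal (T.total i) := by
    rw [tsum_eq_sum (s := T.nbr i), total, ENNReal.ofReal_sum_of_nonneg]
    · exact fun y _ => T.rate_nonneg _ _
    · intro y hy; rw [T.rate_of_not_mem_nbr hy, ENNReal.ofReal_zero]
  change (ENNReal.ofReal (T.rate (some i) y) *
    (∑' y : Option I, ENNReal.ofReal (T.rate (some i) y))⁻¹).toReal = _
  rw [h1, ENNReal.toReal_mul, ENNReal.toReal_inv, ENNReal.toReal_ofReal (T.rate_nonneg _ _),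
    ENNReal.toReal_ofReal (T.total_pos i).le, mul_comm]

lemma integrable_of_abs_le {α : Type*} [MeasurableSpace α] {ν : Measure α} [IsFiniteMeasure ν]
    {f : α → ℝ} (hf : Measurable f) {c : ℝ} (hc : ∀ x, |f x| ≤ c) : Integrable f ν :=
  Integrable.of_bound hf.aestronglyMeasurable c (.of_forall hc)

lemma integral_step {φ : Option I → ℝ} {c : ℝ} (hc : ∀ x, |φ x| ≤ c) (x : Option I) :
    ∫ y, φ (State.toOption y) ∂(T.step (.ofOption x)).toMeasure = T.avg φ x := by
  have hm : Measurable (fun y : State I => φ y.toOption) := measurable_from_top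
  have hP : IsProbabilityMeasure (T.step (.ofOption x)).toMeasure :=
    PMF.toMeasure.isProbabilityMeasure _
  rw [PMF.integral_eq_tsum _ _ (integrable_of_abs_le hm fun y => hc _)]
  cases x with
  | none =>
    have e : T.step (.ofOption none) = PMF.pure (.ofOption none) := rfl
    rw [e, tsum_eq_single (.ofOption none : State I)]
    · rw [PMF.pure_apply, if_pos rfl, ENNReal.toReal_one, one_smul]; rfl
    · intro y hy
      rw [PMF.pure_apply, if_neg hy]; simp
  | some i =>
    have h1 : ∀ y : Option I, (T.step (.ofOption (some i)) (.ofOption y)).toReal • φ y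
        = (T.total i)⁻¹ * (T.rate (some i) y * φ y) := by
      intro y; rw [step_apply_toReal, smul_eq_mul, mul_assoc]
    change ∑' y : Option I, (T.step (.ofOption (some i)) (.ofOption y)).toReal • φ y = _
    simp_rw [h1]
    rw [tsum_mul_left]
    simp only [avg]
    congr 1
    refine tsum_eq_sum fun y hy => ?_
    rw [T.rate_of_not_mem_nbr hy, zero_mul]

/-! ### Path space: Markov property, reversibility and transience of the sites. -/

instance isProbabilityMeasure_pathLaw (i : I) : IsProbabilityMeasure (T.pathLaw i) := by
  unfold pathLaw
  exact (inferInstance : IsMarkovKernel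
    (Kernel.traj (X := fun _ => State I) T.pastKernel 0)).isProbabilityMeasure _

variable (I) in
/-- The filtration of the jump chain. -/
def pathFiltration : Filtration ℕ (MeasurableSpace.pi : MeasurableSpace (ℕ → State I)) :=
  Filtration.piLE (X := fun _ : ℕ => State I)

lemma measurable_comp_pos (φ : Option I → ℝ) (n : ℕ) :
    Measurable (fun ω : ℕ → State I => φ (pos n ω)) :=
  (measurable_from_top (f := φ)).comp (measurable_pos n)

lemma measurable_pos_pathFiltration (n : ℕ) :
    Measurable[pathFiltration I n] (pos n : (ℕ → State I) → Option I) := by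
  have h : (pos n : (ℕ → State I) → Option I) =
      (fun x : (k : Set.Iic n) → State I => (x ⟨n, Set.mem_Iic.2 le_rfl⟩).toOption) ∘
        Preorder.restrictLe n := rfl
  rw [h]
  have h1 : Measurable fun x : (k : Set.Iic n) → State I =>
      (x ⟨n, Set.mem_Iic.2 le_rfl⟩).toOption :=
    (measurable_from_top (f := State.toOption)).comp
      (measurable_pi_apply (⟨n, Set.mem_Iic.2 le_rfl⟩ : Set.Iic n))
  exact h1.comp (comap_measurable _)

lemma measurable_comp_pos_pathFiltration (φ : Option I → ℝ) (n : ℕ) :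
    Measurable[pathFiltration I n] (fun ω : ℕ → State I => φ (pos n ω)) :=
  (measurable_from_top (f := φ)).comp (measurable_pos_pathFiltration n)

/-- The Markov property: `pastKernel` looks only at the last coordinate of the past. -/
lemma condExp_step {φ : Option I → ℝ} {c : ℝ} (hc : ∀ x, |φ x| ≤ c) (n : ℕ) :
    (T.pathLaw T.root)[fun ω => φ (pos (n + 1) ω) | pathFiltration I n]
      =ᵐ[T.pathLaw T.root] fun ω => T.avg φ (pos n ω) := by
  have h := Kernel.condExp_traj (κ := T.pastKernel) (Nat.zero_le n)
    (x₀ := fun _ => .ofOption (some T.root)) (f := fun ω : ℕ → State I => φ (pos (n + 1) ω))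
    (integrable_of_abs_le (measurable_comp_pos φ _) fun ω => hc _)
  refine h.trans (.of_forall fun ω => ?_)
  have h1 : ∫ y, φ (pos (n + 1) y) ∂(Kernel.traj T.pastKernel n (Preorder.frestrictLe n ω))
      = ∫ y, φ (State.toOption y) ∂((Kernel.traj T.pastKernel n).map (fun x => x (n + 1))
        (Preorder.frestrictLe n ω)) := by
    rw [Kernel.map_apply _ (measurable_pi_apply _),
      integral_map (measurable_pi_apply _).aemeasurable]
    · rfl
    · exact (measurable_from_top (f := fun y : State I => φ y.toOption)).aestronglyMeasurable
  refine h1.trans ?_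
  rw [Kernel.map_traj_succ_self]
  exact T.integral_step hc (pos n ω)

lemma setIntegral_step {φ : Option I → ℝ} {c : ℝ} (hc : ∀ x, |φ x| ≤ c) (n : ℕ)
    {s : Set (ℕ → State I)} (hs : MeasurableSet[pathFiltration I n] s) :
    ∫ ω in s, φ (pos (n + 1) ω) ∂T.pathLaw T.root
      = ∫ ω in s, T.avg φ (pos n ω) ∂T.pathLaw T.root := by
  rw [← setIntegral_condExp ((pathFiltration I).le n)
    (integrable_of_abs_le (measurable_comp_pos φ _) fun ω => hc _) hs]
  exact integral_congr_ae (ae_restrict_of_ae (T.condExp_step hc n))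

lemma integral_step_path {φ : Option I → ℝ} {c : ℝ} (hc : ∀ x, |φ x| ≤ c) (n : ℕ) :
    ∫ ω, φ (pos (n + 1) ω) ∂T.pathLaw T.root = ∫ ω, T.avg φ (pos n ω) ∂T.pathLaw T.root := by
  simpa using T.setIntegral_step hc n (s := univ) .univ

lemma ae_start : ∀ᵐ ω ∂T.pathLaw T.root, pos 0 ω = some T.root := by
  have h := Kernel.traj_map_frestrictLe_apply (X := fun _ => State I) (κ := T.pastKernel) 0 0
    (fun _ => State.ofOption (some T.root))
  rw [Kernel.partialTraj_self, Kernel.id_apply] at h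
  have h1 : ∀ᵐ x ∂((T.pathLaw T.root).map (Preorder.frestrictLe 0)),
      (x ⟨0, by simp⟩ : State I).toOption = some T.root := by
    refine (congrArg
      (fun ν => ∀ᵐ x ∂ν, (x ⟨0, by simp⟩ : State I).toOption = some T.root) h).mpr ?_
    rw [ae_dirac_iff]
    · rfl
    · have h1 : Measurable fun x : (k : Finset.Iic 0) → State I =>
          (x ⟨0, by simp⟩ : State I).toOption :=
        (measurable_from_top (f := State.toOption)).comp
          (measurable_pi_apply (⟨0, by simp⟩ : Finset.Iic 0))
      exact h1 (measurableSet_singleton (some T.root))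
  exact ae_of_ae_map (Preorder.measurable_frestrictLe 0).aemeasurable h1

lemma integral_start (φ : Option I → ℝ) :
    ∫ ω, φ (pos 0 ω) ∂T.pathLaw T.root = φ (some T.root) := by
  rw [integral_congr_ae (g := fun _ => φ (some T.root))]
  · simp
  · filter_upwards [T.ae_start] with ω hω
    rw [hω]

open Classical in
-- A transition of probability zero almost surely does not occur at time $n$, and there are only
-- countably many pairs of states.
lemma ae_step (n : ℕ) : ∀ᵐ ω ∂T.pathLaw T.root,
    (∀ i, pos n ω = some i → pos (n + 1) ω ∈ T.nbr i) ∧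
      (pos n ω = none → pos (n + 1) ω = none) := by
  have := T.countable_sites
  have key : ∀ x y : Option I, T.avg (fun z => if z = y then 1 else 0) x = 0 →
      ∀ᵐ ω ∂T.pathLaw T.root, pos n ω = x → pos (n + 1) ω ≠ y := by
    intro x y hxy
    have hs : MeasurableSet[pathFiltration I n] {ω : ℕ → State I | pos n ω = x} :=
      measurable_pos_pathFiltration n (measurableSet_singleton x)
    have hs' := (pathFiltration I).le n _ hs
    have hc : ∀ z : Option I, |if z = y then (1 : ℝ) else 0| ≤ 1 := by
      intro z; split <;> simp
    have h1 := T.setIntegral_step hc n hs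
    have h2 : ∫ ω in {ω : ℕ → State I | pos n ω = x},
        T.avg (fun z => if z = y then 1 else 0) (pos n ω)
        ∂T.pathLaw T.root = 0 := by
      rw [setIntegral_congr_fun hs' (g := fun _ => 0)]
      · simp
      · intro ω hω
        change T.avg _ (pos n ω) = 0
        rw [show pos n ω = x from hω, hxy]
    rw [h2, setIntegral_eq_zero_iff_of_nonneg_ae] at h1
    · rw [Filter.EventuallyEq, ae_restrict_iff' hs'] at h1
      filter_upwards [h1] with ω hω hx hy
      have := hω hx
      simp [hy] at this
    · exact .of_forall fun ω => by dsimp; split <;> simp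
    · exact (integrable_of_abs_le (measurable_comp_pos (fun z => if z = y then 1 else 0) _)
        fun ω => hc _).integrableOn
  have hall : ∀ᵐ ω ∂T.pathLaw T.root, ∀ x y : Option I,
      T.avg (fun z => if z = y then 1 else 0) x = 0 → pos n ω = x → pos (n + 1) ω ≠ y := by
    rw [ae_all_iff]; intro x
    rw [ae_all_iff]; intro y
    by_cases hxy : T.avg (fun z => if z = y then 1 else 0) x = 0
    · filter_upwards [key x y hxy] with ω hω _ using hω
    · exact .of_forall fun ω h => absurd h hxy
  filter_upwards [hall] with ω hω
  refine ⟨fun i hi => ?_, fun hn => ?_⟩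
  · by_contra hmem
    refine hω (some i) (pos (n + 1) ω) ?_ hi rfl
    simp only [avg, mul_ite, mul_one, mul_zero]
    rw [Finset.sum_ite_eq', if_neg hmem, mul_zero]
  · by_contra hne
    refine hω none (pos (n + 1) ω) ?_ hn rfl
    rw [avg_none, if_neg]
    exact fun e => hne e.symm

open Classical in
lemma integral_indicator_eval (n : ℕ) (y : Option I) :
    ∫ ω, (if pos n ω = y then (1 : ℝ) else 0) ∂T.pathLaw T.root
      = (T.pathLaw T.root).real {ω | pos n ω = y} := by
  have hs : MeasurableSet {ω : ℕ → State I | pos n ω = y} :=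
    measurable_pos n (measurableSet_singleton y)
  rw [← integral_indicator_one hs]
  refine integral_congr_ae (.of_forall fun ω => ?_)
  simp [Set.indicator_apply]

open Classical in
/-- Reversibility of the jump chain. -/
lemma prob_eval (n : ℕ) (i : I) : (T.pathLaw T.root).real {ω | pos n ω = some i}
    = T.returnProb n (some i) * T.total i / T.total T.root := by
  induction n generalizing i with
  | zero =>
    rw [← integral_indicator_eval, T.integral_start fun y => if y = some i then 1 else 0]
    by_cases h : i = T.root
    · subst h
      simp [returnProb, (T.total_pos _).ne']
    · simp [returnProb, h, Ne.symm h]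
  | succ n ih =>
    have hc : ∀ z : Option I, |if z = some i then (1 : ℝ) else 0| ≤ 1 := by
      intro z; split <;> simp
    rw [← integral_indicator_eval, T.integral_step_path hc n]
    -- The transition probability into $i$ as a function of the present state; it is 0 at
    -- $\partial_r$, which is absorbing. Symmetry of the rates lets the sum run over the neighbours
    -- of $i$.
    set g : Option I → ℝ := fun y => y.elim 0 fun j => (T.total j)⁻¹ * T.rate (some j) (some i)
      with hg
    have h1 : ∀ x : Option I, T.avg (fun z => if z = some i then 1 else 0) x
        = ∑ y ∈ T.nbr i, g y * if x = y then 1 else 0 := by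
      intro x
      simp only [mul_ite, mul_one, mul_zero, Finset.sum_ite_eq]
      cases x with
      | none => simp [hg]
      | some j =>
        simp only [avg, mul_ite, mul_one, mul_zero, Finset.sum_ite_eq', hg, Option.elim_some]
        have h2 : some i ∈ T.nbr j ↔ some j ∈ T.nbr i := by
          rw [mem_nbr, mem_nbr, rate_symm]
        simp only [h2]
    simp_rw [h1]
    rw [integral_finsetSum]
    · simp_rw [integral_const_mul, integral_indicator_eval]
      simp only [returnProb, avg]
      rw [mul_div_assoc, mul_comm (T.total i)⁻¹, mul_assoc, ← mul_div_assoc,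
        inv_mul_cancel₀ (T.total_pos i).ne', Finset.sum_mul]
      refine Finset.sum_congr rfl fun y _ => ?_
      cases y with
      | none => simp [hg]
      | some j =>
        rw [ih, hg]
        simp only [Option.elim_some]
        rw [T.rate_symm i j]
        have := (T.total_pos j).ne'
        field_simp
    · intro y _
      refine Integrable.const_mul ?_ _
      refine integrable_of_abs_le (c := 1)
        (measurable_comp_pos (fun z => if z = y then 1 else 0) n) ?_
      intro ω; split <;> simp

/-- The expected number of visits to a site. -/
lemma tendsto_sum_prob_eval (i : I) :
    Tendsto (fun n => ∑ m ∈ Finset.range n,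
      (T.pathLaw T.root).real {ω | pos m ω = some i}) atTop
      (𝓝 (T.w 0 * T.hit (some i) * T.total i)) := by
  have hr := (T.total_pos T.root).ne'
  have h := (T.tendsto_sum_returnProb i).mul_const (T.total i / T.total T.root)
  have e : T.total T.root * T.w 0 * T.hit (some i) * (T.total i / T.total T.root)
      = T.w 0 * T.hit (some i) * T.total i := by field_simp
  rw [e] at h
  refine h.congr fun n => ?_
  rw [Finset.sum_mul]
  exact Finset.sum_congr rfl fun m _ => by rw [prob_eval, mul_div_assoc]

/-- Borel–Cantelli: the expected number of visits is finite, since absorption from the root already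
bounds the Green function. -/
lemma ae_eventually_ne (i : I) :
    ∀ᵐ ω ∂T.pathLaw T.root, ∀ᶠ n in atTop, pos n ω ≠ some i := by
  refine ae_eventually_notMem (s := fun n => {ω | pos n ω = some i}) ?_
  have hs : Summable fun n => (T.pathLaw T.root).real {ω | pos n ω = some i} :=
    ((hasSum_iff_tendsto_nat_of_nonneg (fun n => measureReal_nonneg) _).2
      (T.tendsto_sum_prob_eval i)).summable
  have h2 := hs.tsum_ofReal_ne_top
  simpa using h2

/-- The martingale `h(X_n)` converges to the indicator function of hitting `∂_r`. -/
lemma ae_tendsto_hit : ∀ᵐ ω ∂T.pathLaw T.root,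
    Tendsto (fun n => T.hit (pos n ω) - T.hitBy 0 (pos n ω)) atTop (𝓝 0) := by
  have hc : ∀ x, |T.hit x| ≤ 1 := fun x => by
    rw [abs_of_nonneg (T.hit_nonneg x)]; exact T.hit_le_one x
  have hc' : ∀ n x, |T.hitBy n x| ≤ 1 := fun n x => by
    rw [abs_of_nonneg (T.hitBy_nonneg n x)]; exact T.hitBy_le_one n x
  have hint : ∀ n, Integrable (fun ω : ℕ → State I => T.hit (pos n ω)) (T.pathLaw T.root) := fun n =>
    integrable_of_abs_le (measurable_comp_pos _ n) fun ω => hc _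
  have hint' : ∀ m n, Integrable (fun ω : ℕ → State I => T.hitBy m (pos n ω)) (T.pathLaw T.root) :=
    fun m n => integrable_of_abs_le (measurable_comp_pos _ n) fun ω => hc' m _
  have hsub : Submartingale (fun n (ω : ℕ → State I) => T.hit (pos n ω)) (pathFiltration I)
      (T.pathLaw T.root) := by
    refine submartingale_nat
      (fun n => (measurable_comp_pos_pathFiltration T.hit n).stronglyMeasurable) hint fun n => ?_
    filter_upwards [T.condExp_step hc n] with ω hω
    rw [hω, avg_hit]
  have hconv := hsub.exists_ae_tendsto_of_bdd (R := 1) fun n => by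
    refine (eLpNorm_le_of_ae_bound (C := 1) (.of_forall fun ω => hc _)).trans ?_
    simp
  have e1 : ∀ n, ∫ ω, T.hit (pos n ω) ∂T.pathLaw T.root = T.hit (some T.root) := by
    intro n
    induction n with
    | zero => exact T.integral_start _
    | succ n ih => rw [T.integral_step_path hc n, ← ih]; simp_rw [avg_hit]
  -- Stated for every `m` because undoing one step of time turns `hitBy m` into `hitBy (m + 1)`.
  have e2 : ∀ n m, ∫ ω, T.hitBy m (pos n ω) ∂T.pathLaw T.root = T.hitBy (m + n) (some T.root) := by
    intro n
    induction n with
    | zero => exact fun m => T.integral_start _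
    | succ n ih =>
      intro m
      rw [T.integral_step_path (hc' m) n]
      exact (ih (m + 1)).trans (by rw [add_right_comm, add_assoc])
  have hlim : Tendsto (fun n => ∫ ω, (T.hit (pos n ω) - T.hitBy 0 (pos n ω)) ∂T.pathLaw T.root)
      atTop (𝓝 0) := by
    have := (T.tendsto_hitBy (some T.root)).const_sub (T.hit (some T.root))
    rw [sub_self] at this
    refine this.congr fun n => ?_
    rw [integral_sub (hint n) (hint' 0 n), e1, e2, zero_add]
  have hnn : ∀ x, 0 ≤ T.hit x - T.hitBy 0 x := fun x => sub_nonneg.2 (T.hitBy_le_hit 0 x)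
  have hlim' : Tendsto (fun n => ∫⁻ ω, ENNReal.ofReal (T.hit (pos n ω) - T.hitBy 0 (pos n ω))
      ∂T.pathLaw T.root) atTop (𝓝 0) := by
    have := ENNReal.tendsto_ofReal hlim
    rw [ENNReal.ofReal_zero] at this
    refine this.congr fun n => ?_
    exact ofReal_integral_eq_lintegral_ofReal ((hint n).sub (hint' 0 n))
      (.of_forall fun ω => hnn _)
  have hmeas : ∀ n, Measurable fun ω : ℕ → State I =>
      ENNReal.ofReal (T.hit (pos n ω) - T.hitBy 0 (pos n ω)) := fun n =>
    (measurable_comp_pos (fun x => T.hit x - T.hitBy 0 x) n).ennreal_ofReal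
  -- The means $h(r)-\mathbb P_r\{X_n=\partial_r\}$ tend to 0, so by Fatou the lower limit of the
  -- nonnegative differences vanishes almost surely. Both terms converge along almost every path,
  -- hence the lower limit is a limit.
  have hfatou := lintegral_liminf_le (μ := T.pathLaw T.root) (u := atTop) hmeas
  rw [hlim'.liminf_eq, nonpos_iff_eq_zero, lintegral_eq_zero_iff (.liminf hmeas)] at hfatou
  filter_upwards [hconv, hfatou, ae_all_iff.2 T.ae_step] with ω ⟨c, hcω⟩ hω hstep
  have h0 : ∃ d, Tendsto (fun n => T.hitBy 0 (pos n ω)) atTop (𝓝 d) := by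
    by_cases hk : ∃ k, pos k ω = none
    · obtain ⟨k, hk⟩ := hk
      refine ⟨1, tendsto_const_nhds.congr' ?_⟩
      filter_upwards [eventually_ge_atTop k] with n hn
      have : pos n ω = none := by
        induction n, hn using Nat.le_induction with
        | base => exact hk
        | succ n _ ih => exact (hstep n).2 ih
      rw [this, hitBy_none]
    · refine ⟨0, tendsto_const_nhds.congr fun n => ?_⟩
      cases hn : pos n ω with
      | none => exact absurd ⟨n, hn⟩ hk
      | some i => rfl
  obtain ⟨d, hd⟩ := h0
  have h1 := hcω.sub hd
  have h2 : ENNReal.ofReal (c - d) = 0 := by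
    rw [← (ENNReal.tendsto_ofReal h1).liminf_eq]; exact hω
  have h3 : 0 ≤ c - d := ge_of_tendsto' h1 fun n => hnn _
  have h4 : c - d = 0 := le_antisymm (ENNReal.ofReal_eq_zero.1 h2) h3
  rwa [h4] at h1

/-! ### Exit from a transient chain -/

/-- The event that the chain finally stays in the branch `[j, ∞)`. -/
def branchEvent (j : I) : Set (ℕ → State I) :=
  {ω | ∀ᶠ k in atTop, ∃ x, pos k ω = some x ∧ T.Prec j x}

lemma measurableSet_branchEvent (j : I) : MeasurableSet (T.branchEvent j) := by
  have h : T.branchEvent j =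
      ⋃ N, ⋂ k ≥ N, (pos k) ⁻¹' {y : Option I | ∃ x, y = some x ∧ T.Prec j x} := by
    ext ω
    simp [branchEvent, eventually_atTop]
  rw [h]
  exact .iUnion fun N => .iInter fun k => .iInter fun _ => measurable_pos k trivial

variable {T}

lemma convergesTo_iff {ω : ℕ → State I} {ξ : T.Boundary} :
    T.ConvergesTo ω ξ ↔ ∀ n, ω ∈ T.branchEvent (ξ n) := Iff.rfl

lemma branchEvent_unique {ω : ℕ → State I} {i j : I} (hi : ω ∈ T.branchEvent i)
    (hj : ω ∈ T.branchEvent j) (hl : T.level i = T.level j) : i = j := by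
  obtain ⟨k, ⟨x, hx, h1⟩, y, hy, h2⟩ := (hi.and hj).exists
  rw [hx, Option.some_inj] at hy
  exact T.prec_unique h1 (hy ▸ h2) hl

lemma ConvergesTo.mem_branchEvent_iff {ω : ℕ → State I} {ξ : T.Boundary} (h : T.ConvergesTo ω ξ)
    {j : I} : ω ∈ T.branchEvent j ↔ ξ ∈ T.cyl j := by
  constructor
  · intro hj
    rw [mem_cyl]
    exact branchEvent_unique (convergesTo_iff.1 h _) hj (ξ.level _)
  · rintro ⟨n, rfl⟩
    exact h n

/-- The branches occupied in the end at levels $n$ and $n+1$ share a site, hence are nested, and the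
selected sites form a geodesic. This expresses exit by countably many measurable events. -/
lemma mem_exitEvent_iff {ω : ℕ → State I} :
    ω ∈ T.exitEvent ↔ ∀ n, ∃ i, T.level i = n ∧ ω ∈ T.branchEvent i := by
  constructor
  · rintro ⟨ξ, h⟩ n
    exact ⟨ξ n, ξ.level n, h n⟩
  · intro h
    choose i hi hω using h
    obtain ⟨ξ, hξ⟩ := T.exists_boundary hi fun n => by
      obtain ⟨k, ⟨x, hx, h1⟩, y, hy, h2⟩ := ((hω n).and (hω (n + 1))).exists
      rw [hx, Option.some_inj] at hy
      subst hy
      cases hp : T.pred (i (n + 1)) with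
      | none =>
        rw [T.pred_eq_none_iff, ← T.level_eq_zero, hi] at hp
        omega
      | some p =>
        have hl := T.level_of_pred hp
        rw [T.prec_unique h1 (T.prec_of_pred hp (T.prec_refl p) |>.trans h2)]
        rw [hi] at hl ⊢
        omega
    refine ⟨ξ, convergesTo_iff.2 fun n => ?_⟩
    rw [hξ]; exact hω n

variable (T)

lemma measurableSet_exitEvent : MeasurableSet T.exitEvent := by
  have := T.countable_sites
  have h : T.exitEvent = ⋂ n, ⋃ i, ⋃ (_ : T.level i = n), T.branchEvent i := by
    ext ω
    rw [mem_exitEvent_iff]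
    simp
  rw [h]
  exact .iInter fun n => .iUnion fun i => .iUnion fun _ => T.measurableSet_branchEvent i

/-- The paths of the jump chain started at the root that are killed or leave every finite set. -/
structure IsChainPath (ω : ℕ → State I) : Prop where
  start : pos 0 ω = some T.root
  step : ∀ n i, pos n ω = some i → pos (n + 1) ω ∈ T.nbr i
  absorbed : ∀ n, pos n ω = none → pos (n + 1) ω = none
  eventually_ne : ∀ i, ∀ᶠ n in atTop, pos n ω ≠ some i
  tendsto : Tendsto (fun n => T.hit (pos n ω) - T.hitBy 0 (pos n ω)) atTop (𝓝 0)

lemma ae_isChainPath : ∀ᵐ ω ∂T.pathLaw T.root, T.IsChainPath ω := by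
  have := T.countable_sites
  filter_upwards [T.ae_start, ae_all_iff.2 T.ae_step, ae_all_iff.2 T.ae_eventually_ne,
    T.ae_tendsto_hit] with ω h1 h2 h3 h4
  exact ⟨h1, fun n => (h2 n).1, fun n => (h2 n).2, h3, h4⟩

variable {T}

lemma IsChainPath.none_of_le {ω : ℕ → State I} (h : T.IsChainPath ω) {k n : ℕ} (hkn : k ≤ n)
    (hk : pos k ω = none) : pos n ω = none := by
  induction n, hkn using Nat.le_induction with
  | base => exact hk
  | succ n _ ih => exact h.absorbed n ih

/-- The path finally leaves the finite ball of radius $n$. From then on it cannot change its branch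
at level $n$, since that would require a visit to a level below $n$. -/
lemma IsChainPath.mem_exitEvent {ω : ℕ → State I} (h : T.IsChainPath ω)
    (h' : ∀ n, pos n ω ≠ none) : ω ∈ T.exitEvent := by
  rw [mem_exitEvent_iff]
  intro n
  have h1 : ∀ᶠ k in atTop, ∀ i ∈ {i | T.level i ≤ n}, pos k ω ≠ some i :=
    ((T.finite_level_le n).eventually_all).2 fun i _ => h.eventually_ne i
  obtain ⟨K, hK⟩ := eventually_atTop.1 h1
  have h2 : ∀ k ≥ K, ∃ x, pos k ω = some x ∧ n < T.level x := by
    intro k hk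
    obtain ⟨x, hx⟩ := Option.ne_none_iff_exists'.1 (h' k)
    refine ⟨x, hx, ?_⟩
    by_contra hn
    exact hK k hk x (not_lt.1 hn) hx
  obtain ⟨x, hx, hl⟩ := h2 K le_rfl
  obtain ⟨i, hi, hp⟩ := T.exists_prec_level hl.le
  refine ⟨i, hi, eventually_atTop.2 ⟨K, fun k hk => ?_⟩⟩
  induction k, hk using Nat.le_induction with
  | base => exact ⟨x, hx, hp⟩
  | succ k hk ih =>
    obtain ⟨y, hy, hpy⟩ := ih
    obtain ⟨z, hz, hlz⟩ := h2 (k + 1) (by omega)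
    refine ⟨z, hz, ?_⟩
    have hs := h.step k y hy
    rw [hz, mem_nbr_iff] at hs
    rcases hs with hs | ⟨c, hc, hs⟩
    · refine hpy.of_pred hs.symm ?_
      rintro rfl
      have := T.level_of_pred hs.symm
      omega
    · rw [Option.some_inj] at hc
      subst hc
      exact T.prec_of_pred hs hpy

/-- A branch can be entered only through its first site: consider the first time at which the path
is in the branch. -/
lemma IsChainPath.exists_pos_eq {ω : ℕ → State I} (h : T.IsChainPath ω) {j : I}
    (hj : ω ∈ T.branchEvent j) : ∃ k, pos k ω = some j := by
  classical
  have hex : ∃ k, ∃ x, pos k ω = some x ∧ T.Prec j x := hj.exists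
  obtain ⟨x, hx, hp⟩ := Nat.find_spec hex
  have hmin := fun m => Nat.find_min hex (m := m)
  cases hk : Nat.find hex with
  | zero =>
    rw [hk, h.start, Option.some_inj] at hx
    subst hx
    refine ⟨0, ?_⟩
    rw [h.start, hp.eq_of_level_le (by simp [level_root])]
  | succ k =>
    rw [hk] at hx
    obtain ⟨y, hy⟩ := Option.ne_none_iff_exists'.1 fun h0 => by
      have := h.absorbed k h0
      simp [hx] at this
    refine ⟨k + 1, ?_⟩
    have hny : ¬ T.Prec j y := fun hpy => hmin k (by omega) ⟨y, hy, hpy⟩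
    have hs := h.step k y hy
    rw [hx, mem_nbr_iff] at hs
    rcases hs with hs | ⟨c, hc, hs⟩
    · exact absurd (T.prec_of_pred hs.symm hp) hny
    · rw [Option.some_inj] at hc
      subst hc
      by_cases hjx : j = x
      · rw [hx, hjx]
      · exact absurd (hp.of_pred hs hjx) hny

lemma IsChainPath.tendsto_hit_of_exit {ω : ℕ → State I} (h : T.IsChainPath ω) {ξ : T.Boundary}
    (hξ : T.ConvergesTo ω ξ) : Tendsto (fun n => T.hit (pos n ω)) atTop (𝓝 0) := by
  refine h.tendsto.congr' ?_
  filter_upwards [hξ 0] with n ⟨x, hx, _⟩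
  have hx' : pos n ω = some x := hx
  rw [hx']
  simp [hitBy]

lemma IsChainPath.tendsto_hit_boundary {ω : ℕ → State I} (h : T.IsChainPath ω) {ξ : T.Boundary}
    (hξ : T.ConvergesTo ω ξ) : Tendsto (fun n => T.hit (some (ξ n))) atTop (𝓝 0) := by
  -- The path visits every $\xi(n)$, at pairwise different times, so $h(\xi(n))$ is read off from
  -- $h(X_k)$ along times tending to infinity.
  choose k hk using fun n => h.exists_pos_eq (convergesTo_iff.1 hξ n)
  have hinj : Function.Injective k := by
    intro m n e
    have := hk m
    rw [e, hk n, Option.some_inj] at this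
    exact (ξ.2.2.2 this).symm
  have hk' : Tendsto k atTop atTop := by
    simpa [Nat.cofinite_eq_atTop] using hinj.tendsto_cofinite
  refine ((h.tendsto_hit_of_exit hξ).comp hk').congr fun n => ?_
  simp [hk]

/-- On the branch event $h(X_n)\to0$. Otherwise the path is absorbed or finally stays in another
branch of the same level, and `stay` is 0 there. -/
lemma IsChainPath.tendsto_stay {ω : ℕ → State I} (h : T.IsChainPath ω) (j : I) :
    Tendsto (fun n => T.stay j (pos n ω)) atTop
      (𝓝 ((T.branchEvent j).indicator (fun _ => (1 : ℝ)) ω)) := by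
  by_cases hn : ∃ k, pos k ω = none
  · obtain ⟨k, hk⟩ := hn
    have h1 : ω ∉ T.branchEvent j := by
      intro hj
      obtain ⟨n, ⟨x, hx, _⟩, hkn⟩ := (hj.and (eventually_ge_atTop k)).exists
      rw [h.none_of_le hkn hk] at hx
      simp at hx
    rw [indicator_of_notMem h1]
    refine tendsto_const_nhds.congr' ?_
    filter_upwards [eventually_ge_atTop k] with n hkn
    rw [h.none_of_le hkn hk, stay_none]
  · push Not at hn
    obtain ⟨ξ, hξ⟩ := h.mem_exitEvent hn
    by_cases hj : ω ∈ T.branchEvent j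
    · rw [indicator_of_mem hj]
      have := (h.tendsto_hit_of_exit hξ).div_const (T.hit (T.pred j)) |>.const_sub 1
      rw [zero_div, sub_zero] at this
      refine this.congr' ?_
      filter_upwards [hj] with n ⟨x, hx, hp⟩
      rw [hx, T.stay_of_prec hp]
    · rw [indicator_of_notMem hj]
      refine tendsto_const_nhds.congr' ?_
      filter_upwards [convergesTo_iff.1 hξ (T.level j)] with n ⟨x, hx, hp⟩
      rw [hx, T.stay_of_not_prec]
      intro hp'
      refine hj ?_
      rw [← T.prec_unique hp hp' (ξ.level _)]
      exact convergesTo_iff.1 hξ _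

variable (T)

open Classical in
lemma avg_stay_of_pred {j x : I} (hp : T.pred j = some x) (y : Option I) :
    T.avg (T.stay j) y = T.stay j y +
      (T.total x)⁻¹ * T.rate (some x) (some j) * T.stay j (some j) *
        if y = some x then 1 else 0 := by
  cases y with
  | none => simp
  | some y =>
    rw [avg_stay, hp, mul_ite, mul_one, mul_zero]
    by_cases h : x = y
    · subst h; simp
    · simp [h, Ne.symm h]

/-- The law of the exit point in terms of the probability of hitting `∂_r`. -/
lemma prob_branchEvent (j : I) :
    T.delta (T.level j) * (T.pathLaw T.root).real (T.branchEvent j)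
      = T.w 0 * (T.hit (T.pred j) - T.hit (some j)) := by
  classical
  have hc := T.abs_stay_le j
  have hint : ∀ n, Integrable (fun ω : ℕ → State I => T.stay j (pos n ω)) (T.pathLaw T.root) :=
    fun n => integrable_of_abs_le (measurable_comp_pos _ n) fun ω => hc _
  -- Bounded convergence gives the probability as a limit of means, which are then computed step by
  -- step from the defect of harmonicity at $j^-$.
  have hlim : Tendsto (fun n => ∫ ω, T.stay j (pos n ω) ∂T.pathLaw T.root) atTop
      (𝓝 ((T.pathLaw T.root).real (T.branchEvent j))) := by
    rw [← integral_indicator_one (T.measurableSet_branchEvent j)]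
    refine tendsto_integral_of_dominated_convergence (fun _ => 1 + 1 / T.hit (T.pred j))
      (fun n => (hint n).aestronglyMeasurable) (integrable_const _)
      (fun n => .of_forall fun ω => hc _) ?_
    filter_upwards [T.ae_isChainPath] with ω hω
    exact hω.tendsto_stay j
  have hd := (T.delta_pos (T.level j)).ne'
  cases hp : T.pred j with
  | none =>
    have hj := T.pred_eq_none_iff.1 hp
    -- For the root there is no site $j^-$: the process is a martingale and its mean is constant.
    have e : ∀ n, ∫ ω, T.stay j (pos n ω) ∂T.pathLaw T.root = 1 - T.hit (some j) := by
      intro n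
      induction n with
      | zero => rw [T.integral_start, ← hj, stay_self, hp, hit_none, div_one]
      | succ n ih =>
        rw [T.integral_step_path hc, ← ih]
        congr with ω
        cases pos n ω with
        | none => rfl
        | some x => rw [avg_stay, hp]; simp
    simp_rw [e] at hlim
    rw [← tendsto_nhds_unique hlim tendsto_const_nhds |>.symm, hit_none, hj, level_root]
    rfl
  | some x =>
    set c := (T.total x)⁻¹ * T.rate (some x) (some j) * T.stay j (some j) with hcdef
    -- The last-exit decomposition: `c` is the chance to jump from $j^-$ to $j$ and then to stay,
    -- and it is collected at each visit to $j^-$. The initial value is 0 because the root lies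
    -- outside the branch.
    have e : ∀ n, ∫ ω, T.stay j (pos n ω) ∂T.pathLaw T.root
        = c * ∑ m ∈ Finset.range n, (T.pathLaw T.root).real {ω | pos m ω = some x} := by
      intro n
      induction n with
      | zero =>
        rw [T.integral_start, T.stay_of_not_prec]
        · simp
        · intro h
          have h1 := h.level_le
          have h2 := T.level_of_pred hp
          rw [level_root] at h1
          omega
      | succ n ih =>
        rw [T.integral_step_path hc, Finset.sum_range_succ, mul_add, ← ih,
          ← T.integral_indicator_eval, ← integral_const_mul, ← integral_add (hint n)]
        · congr with ω
          rw [T.avg_stay_of_pred hp]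
        · refine Integrable.const_mul (integrable_of_abs_le (c := 1)
            (measurable_comp_pos (fun z => if z = some x then 1 else 0) n) ?_) _
          intro ω; split <;> simp
    simp_rw [e] at hlim
    rw [tendsto_nhds_unique hlim ((T.tendsto_sum_prob_eval x).const_mul c), hcdef, stay_self, hp,
      T.rate_of_pred hp]
    have h1 := (T.total_pos x).ne'
    have h2 := (T.hit_pos (some x)).ne'
    field_simp

/-! ### The exit measure -/

variable {T}

lemma exitPoint_mem_cyl {ω : T.exitEvent} {j : I} :
    T.exitPoint ω ∈ T.cyl j ↔ (ω : ℕ → State I) ∈ T.branchEvent j :=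
  (ConvergesTo.mem_branchEvent_iff (Classical.choose_spec ω.2)).symm

variable (T)

lemma measurable_exitPoint : Measurable T.exitPoint := by
  refine measurable_generateFrom ?_
  rintro _ ⟨j, rfl⟩
  have h : T.exitPoint ⁻¹' T.cyl j = ((↑) : T.exitEvent → ℕ → State I) ⁻¹' T.branchEvent j := by
    ext ω; exact exitPoint_mem_cyl
  rw [h]
  exact measurable_subtype_coe (T.measurableSet_branchEvent j)

variable {T}

lemma exitProb_ne_top : T.exitProb ≠ ∞ := measure_ne_top _ _

/-- Almost every path that is not absorbed exits, so exit probability zero would mean almost sure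
absorption. -/
lemma Transient.exitProb_ne_zero (hT : T.Transient) : T.exitProb ≠ 0 := by
  intro h
  have h1 : ∀ᵐ ω ∂T.pathLaw T.root, ω ∉ T.exitEvent := measure_eq_zero_iff_ae_notMem.1 h
  refine hT.ne ?_
  rw [← measure_univ (μ := T.pathLaw T.root)]
  refine measure_congr ?_
  filter_upwards [h1, T.ae_isChainPath] with ω hω hp
  refine propext ⟨fun _ => trivial, fun _ => ?_⟩
  by_contra hn
  exact hω (hp.mem_exitEvent fun n hn' => hn ⟨n, hn'⟩)

lemma exitMeasure_apply {s : Set T.Boundary} (hs : MeasurableSet s) :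
    T.exitMeasure s = T.exitProb⁻¹ *
      T.pathLaw T.root (((↑) : T.exitEvent → ℕ → State I) '' (T.exitPoint ⁻¹' s)) := by
  rw [exitMeasure, Measure.smul_apply, Measure.map_apply T.measurable_exitPoint hs,
    comap_subtype_coe_apply T.measurableSet_exitEvent, smul_eq_mul]

lemma Transient.isProbabilityMeasure (hT : T.Transient) : IsProbabilityMeasure T.exitMeasure := by
  constructor
  rw [exitMeasure_apply .univ, preimage_univ, image_univ, Subtype.range_coe]
  exact ENNReal.inv_mul_cancel hT.exitProb_ne_zero exitProb_ne_top

lemma Transient.alpha_pos (hT : T.Transient) : 0 < T.alpha :=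
  div_pos (T.w_pos 0) (ENNReal.toReal_pos hT.exitProb_ne_zero exitProb_ne_top)

/-- This is `prob_branchEvent` divided by the exit probability. Up to a null set, the branch event
is exit through $C_j$, since a path that stays in a branch is never absorbed. -/
lemma delta_mul_exitMeasure_cyl (j : I) :
    T.delta (T.level j) * T.exitMeasure.real (T.cyl j)
      = T.alpha * (T.hit (T.pred j) - T.hit (some j)) := by
  have h1 : T.pathLaw T.root (((↑) : T.exitEvent → ℕ → State I) '' (T.exitPoint ⁻¹' T.cyl j))
      = T.pathLaw T.root (T.branchEvent j) := by
    refine measure_congr ?_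
    filter_upwards [T.ae_isChainPath] with ω hω
    refine propext ⟨?_, fun h => ?_⟩
    · rintro ⟨x, hx, rfl⟩
      exact exitPoint_mem_cyl.1 hx
    · have hn : ∀ n, pos n ω ≠ none := by
        intro k hk
        obtain ⟨n, ⟨x, hx, _⟩, hkn⟩ := (Filter.Eventually.and h (eventually_ge_atTop k)).exists
        rw [hω.none_of_le hkn hk] at hx
        simp at hx
      exact ⟨⟨ω, hω.mem_exitEvent hn⟩, exitPoint_mem_cyl.2 h, rfl⟩
  rw [measureReal_def, exitMeasure_apply (measurableSet_cyl j), h1, ENNReal.toReal_mul,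
    ENNReal.toReal_inv, alpha, mul_left_comm, ← measureReal_def, prob_branchEvent]
  ring

lemma measurable_comp_apply {β : Type*} [MeasurableSpace β] (φ : I → β) (n : ℕ) :
    Measurable fun ξ : T.Boundary => φ (ξ n) := by
  have := T.countable_sites
  intro s _
  have h : (fun ξ : T.Boundary => φ (ξ n)) ⁻¹' s
      = ⋃ i, ⋃ (_ : φ i ∈ s ∧ T.level i = n), T.cyl i := by
    ext ξ
    simp only [mem_preimage, mem_iUnion, mem_cyl, exists_prop]
    constructor
    · intro hξ
      exact ⟨ξ n, ⟨hξ, ξ.level n⟩, by rw [ξ.level]⟩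
    · rintro ⟨i, ⟨hi, rfl⟩, e⟩
      rwa [e]
  rw [h]
  exact .iUnion fun i => .iUnion fun _ => measurableSet_cyl i

lemma ae_tendsto_hit_boundary :
    ∀ᵐ ξ ∂T.exitMeasure, Tendsto (fun n => T.hit (some (ξ n))) atTop (𝓝 0) := by
  have hm : MeasurableSet {ξ : T.Boundary | Tendsto (fun n => T.hit (some (ξ n))) atTop (𝓝 0)} :=
    measurableSet_tendsto _ fun n => measurable_comp_apply (fun i => T.hit (some i)) n
  change T.exitMeasure {ξ : T.Boundary | Tendsto (fun n => T.hit (some (ξ n))) atTop (𝓝 0)}ᶜ = 0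
  rw [exitMeasure_apply hm.compl]
  refine mul_eq_zero_of_right _ (measure_mono_null ?_ (ae_iff.1 T.ae_isChainPath))
  rintro _ ⟨ω, hω, rfl⟩ h
  exact hω (h.tendsto_hit_boundary (Classical.choose_spec ω.2))

variable (T)

/-! ### The potential `G_n` -/

/-- The values `α h(η(n - 1))`, with `h(∂_r) = 1`, of `G_n` outside a null set. -/
def pot (n : ℕ) (η : T.Boundary) : ℝ := T.alpha * T.hit (T.pred (η n))

variable {T}

lemma pot_zero (η : T.Boundary) : T.pot 0 η = T.alpha := by
  rw [pot, η.2.1, pred_root, hit_none, mul_one]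

lemma pot_succ (n : ℕ) (η : T.Boundary) : T.pot (n + 1) η = T.alpha * T.hit (some (η n)) := by
  rw [pot, η.pred]

lemma Transient.pot_pos (hT : T.Transient) (n : ℕ) (η : T.Boundary) : 0 < T.pot n η :=
  mul_pos hT.alpha_pos (T.hit_pos _)

lemma delta_mul_exitMeasure_C (n : ℕ) (η : T.Boundary) :
    T.delta n * T.exitMeasure.real (T.C n η) = T.pot n η - T.pot (n + 1) η := by
  have h := T.delta_mul_exitMeasure_cyl (η n)
  rw [η.level] at h
  rw [C, h, pot, pot_succ, mul_sub]

lemma pot_antitone (η : T.Boundary) : Antitone fun n => T.pot n η := by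
  refine antitone_nat_of_succ_le fun n => ?_
  have h := delta_mul_exitMeasure_C n η
  have := mul_nonneg (T.delta_pos n).le (measureReal_nonneg (μ := T.exitMeasure) (s := T.C n η))
  linarith

/-- Predictability: the bound `m + 1` instead of `m` is what later allows $1/G_{m+1}$ to be pulled
out of integrals over $C^m$. -/
lemma pot_congr {n m : ℕ} (h : n ≤ m + 1) {ξ η : T.Boundary} (e : ξ m = η m) :
    T.pot n ξ = T.pot n η := by
  cases n with
  | zero => rw [pot_zero, pot_zero]
  | succ n => rw [pot_succ, pot_succ, Boundary.eq_of_le (by omega) e]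

/-- The boundary points along which the probability of hitting `∂_r` vanishes. -/
def IsRegular (η : T.Boundary) : Prop := Tendsto (fun n => T.hit (some (η n))) atTop (𝓝 0)

/-- The series telescopes by `delta_mul_exitMeasure_C`, and regularity kills the remainder. -/
lemma IsRegular.hasSum {η : T.Boundary} (h : IsRegular η) (n : ℕ) :
    HasSum (fun k => T.delta (n + k) * T.exitMeasure.real (T.C (n + k) η)) (T.pot n η) := by
  rw [hasSum_iff_tendsto_nat_of_nonneg
    (fun k => mul_nonneg (T.delta_pos _).le measureReal_nonneg)]
  have h1 : Tendsto (fun m => T.pot m η) atTop (𝓝 0) := by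
    rw [← tendsto_add_atTop_iff_nat 1]
    simpa [pot_succ] using Tendsto.const_mul T.alpha h
  have h2 : Tendsto (fun m => T.pot (n + m) η) atTop (𝓝 0) := by
    simpa [add_comm] using (tendsto_add_atTop_iff_nat n).2 h1
  have h3 := h2.const_sub (T.pot n η)
  rw [sub_zero] at h3
  refine h3.congr fun m => ?_
  simp_rw [delta_mul_exitMeasure_C]
  have := Finset.sum_range_sub' (fun k => T.pot (n + k) η) m
  simpa [add_assoc] using this.symm

lemma IsRegular.G_eq {η : T.Boundary} (h : IsRegular η) (n : ℕ) : T.G n η = T.pot n η :=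
  (h.hasSum n).tsum_eq

lemma ae_isRegular : ∀ᵐ η ∂T.exitMeasure, IsRegular η := ae_tendsto_hit_boundary

lemma ae_exitMeasure_C_ne_zero [IsFiniteMeasure T.exitMeasure] :
    ∀ᵐ η ∂T.exitMeasure, ∀ n, T.exitMeasure.real (T.C n η) ≠ 0 := by
  have := T.countable_sites
  have h : ∀ j : I, ∀ᵐ η ∂T.exitMeasure, T.exitMeasure (T.cyl j) = 0 → η ∉ T.cyl j := by
    intro j
    by_cases hj : T.exitMeasure (T.cyl j) = 0
    · filter_upwards [measure_eq_zero_iff_ae_notMem.1 hj] with η hη _ using hη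
    · exact .of_forall fun η h => absurd h hj
  filter_upwards [ae_all_iff.2 h] with η hη n hn
  exact hη _ ((measureReal_eq_zero_iff).1 hn) ⟨n, rfl⟩

/-! ### Functions of the first sites of a boundary point -/

/-- `f(η)` only depends on `η(n)`. -/
def IsLevel {β : Type*} (n : ℕ) (f : T.Boundary → β) : Prop := ∀ ξ η, ξ n = η n → f ξ = f η

lemma IsLevel.mono {β : Type*} {n m : ℕ} {f : T.Boundary → β} (h : IsLevel n f) (hnm : n ≤ m) :
    IsLevel m f :=
  fun ξ η e => h ξ η (Boundary.eq_of_le hnm e)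

variable (T) in
/-- The sites of level `n`. -/
def sites (n : ℕ) : Finset I := (T.finite_level n).toFinset

lemma mem_sites {n : ℕ} {i : I} : i ∈ T.sites n ↔ T.level i = n := by simp [sites]

lemma IsLevel.exists_eq {n : ℕ} {f : T.Boundary → ℝ} (h : IsLevel n f) :
    ∃ φ : I → ℝ, f = fun η => φ (η n) := by
  have h1 : Function.FactorsThrough f fun η : T.Boundary => η n := fun ξ η e => h ξ η e
  exact ⟨Function.extend (fun η : T.Boundary => η n) f 0,
    funext fun η => (h1.extend_apply 0 η).symm⟩

lemma IsLevel.measurable {n : ℕ} {f : T.Boundary → ℝ} (h : IsLevel n f) : Measurable f := by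
  obtain ⟨φ, rfl⟩ := h.exists_eq
  exact measurable_comp_apply φ n

lemma IsLevel.exists_bound {n : ℕ} {f : T.Boundary → ℝ} (h : IsLevel n f) :
    ∃ c, ∀ η, |f η| ≤ c := by
  obtain ⟨φ, rfl⟩ := h.exists_eq
  refine ⟨∑ i ∈ T.sites n, |φ i|, fun η => ?_⟩
  exact Finset.single_le_sum (f := fun i => |φ i|) (fun i _ => abs_nonneg _)
    (mem_sites.2 (η.level n))

lemma measurableSet_C (n : ℕ) (η : T.Boundary) : MeasurableSet (T.C n η) := measurableSet_cyl _

lemma integral_eq_sum_cyl {F : T.Boundary → ℝ} (hF : Integrable F T.exitMeasure) (n : ℕ) :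
    ∫ η, F η ∂T.exitMeasure = ∑ j ∈ T.sites n, ∫ η in T.cyl j, F η ∂T.exitMeasure := by
  rw [← integral_biUnion_finset _ (fun j _ => measurableSet_cyl j) ?_ fun j _ => hF.integrableOn]
  · have h : ⋃ j ∈ T.sites n, T.cyl j = univ := by
      refine eq_univ_of_forall fun η => ?_
      simp only [mem_iUnion]
      exact ⟨η n, mem_sites.2 (η.level n), n, rfl⟩
    rw [h, setIntegral_univ]
  · intro i hi j hj hij
    refine Set.disjoint_left.2 fun η h1 h2 => hij ?_
    rw [mem_cyl] at h1 h2
    rw [Finset.mem_coe, mem_sites] at hi hj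
    rw [← h1, ← h2, hi, hj]

variable (T) in
/-- The conditional expectation given the first `n` sites. -/
def cond (n : ℕ) (f : T.Boundary → ℝ) (η : T.Boundary) : ℝ :=
  (T.exitMeasure.real (T.C n η))⁻¹ * ∫ ξ in T.C n η, f ξ ∂T.exitMeasure

lemma isLevel_cond (n : ℕ) (f : T.Boundary → ℝ) : IsLevel n (T.cond n f) := by
  intro ξ η e
  unfold cond C
  rw [e]

lemma IsLevel.setIntegral {n m : ℕ} (hnm : n ≤ m) {f : T.Boundary → ℝ} (h : IsLevel n f)
    (η : T.Boundary) :
    ∫ ξ in T.C m η, f ξ ∂T.exitMeasure = f η * T.exitMeasure.real (T.C m η) := by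
  rw [setIntegral_congr_fun (g := fun _ => f η) (measurableSet_C m η)]
  · simp [mul_comm]
  · intro ξ hξ
    exact h.mono hnm ξ η (mem_C.1 hξ)

lemma IsLevel.integrable [IsFiniteMeasure T.exitMeasure] {n : ℕ} {f : T.Boundary → ℝ}
    (h : IsLevel n f) : Integrable f T.exitMeasure :=
  integrable_of_abs_le h.measurable h.exists_bound.choose_spec

/-- Pulling out a function of the first `n` sites. -/
lemma setIntegral_mul_eq_zero {n k : ℕ} (hkn : k ≤ n) {f g : T.Boundary → ℝ}
    (hf : Integrable f T.exitMeasure) (hg : IsLevel n g)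
    (h0 : ∀ η, ∫ ξ in T.C n η, f ξ ∂T.exitMeasure = 0) (η : T.Boundary) :
    ∫ ξ in T.C k η, g ξ * f ξ ∂T.exitMeasure = 0 := by
  have hm := measurableSet_C k η
  -- Decompose into the cylinders of level $n$: on each of them both `g` and the indicator of
  -- $C^k(\eta)$ are constant, as $k\le n$.
  rw [← integral_indicator hm, integral_eq_sum_cyl _ n]
  · refine Finset.sum_eq_zero fun j hj => ?_
    rcases (T.cyl j).eq_empty_or_nonempty with he | ⟨ξ, hξ⟩
    · rw [he, Measure.restrict_empty, integral_zero_measure]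
    rw [mem_cyl, mem_sites.1 hj] at hξ
    have e : T.cyl j = T.C n ξ := by rw [C, hξ]
    rw [e, setIntegral_congr_fun (g := fun ζ => (T.C k η).indicator g ξ * f ζ)
      (measurableSet_C n ξ), integral_const_mul, h0, mul_zero]
    intro ζ hζ
    have hζ' := mem_C.1 hζ
    have hk := Boundary.eq_of_le hkn hζ'
    have hiff : ζ ∈ T.C k η ↔ ξ ∈ T.C k η := by rw [mem_C, mem_C, hk]
    by_cases hz : ξ ∈ T.C k η
    · change (T.C k η).indicator _ ζ = _
      rw [indicator_of_mem (hiff.2 hz)]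
      dsimp only
      rw [indicator_of_mem hz, hg ζ ξ hζ']
    · change (T.C k η).indicator _ ζ = _
      rw [indicator_of_notMem (mt hiff.1 hz)]
      dsimp only
      rw [indicator_of_notMem hz, zero_mul]
  · obtain ⟨c, hc⟩ := hg.exists_bound
    exact (hf.bdd_mul hg.measurable.aestronglyMeasurable (.of_forall hc)).indicator hm

/-! ### The kernel `U` -/

lemma meetLevel_comm (ξ η : T.Boundary) : T.meetLevel ξ η = T.meetLevel η ξ := by
  simp only [meetLevel, eq_comm (a := ξ.1 _)]

lemma U_comm (ξ η : T.Boundary) : T.U ξ η = T.U η ξ := by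
  by_cases h : ξ = η
  · rw [h]
  · rw [U, U, if_neg h, if_neg (Ne.symm h), meetLevel_comm]

lemma le_meetLevel_iff {ξ η : T.Boundary} (hne : ξ ≠ η) {n : ℕ} :
    n ≤ T.meetLevel ξ η ↔ ξ n = η n := by
  obtain ⟨m, hm⟩ : ∃ m, ξ m ≠ η m := by
    by_contra h
    push Not at h
    exact hne (Boundary.ext h)
  have hb : BddAbove {n | ξ n = η n} :=
    ⟨m, fun k hk => le_of_not_ge fun hmk => hm (Boundary.eq_of_le hmk hk)⟩
  have hmem := Nat.sSup_mem (s := {n | ξ n = η n}) ⟨0, ξ.2.1.trans η.2.1.symm⟩ hb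
  exact ⟨fun h => Boundary.eq_of_le h hmem, fun h => le_csSup hb h⟩

variable (T) in
lemma sum_delta (n : ℕ) : ∑ k ∈ Finset.range (n + 1), T.delta k = T.w n := by
  induction n with
  | zero => simp [delta]
  | succ n ih => rw [Finset.sum_range_succ, ih, delta]; ring

open Classical in
-- The increments telescope to $w$. On the diagonal every level contributes, and both sides may be
-- infinite. Integrals against $U$ thereby become sums over the cylinders $C^k(\eta)$.
lemma U_eq_tsum (ξ η : T.Boundary) :
    T.U ξ η = ∑' k, if ξ k = η k then ENNReal.ofReal (T.delta k) else 0 := by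
  have hsum : ∀ n, ENNReal.ofReal (T.w n)
      = ∑ k ∈ Finset.range (n + 1), ENNReal.ofReal (T.delta k) := by
    intro n
    rw [← ENNReal.ofReal_sum_of_nonneg fun k _ => (T.delta_pos k).le, sum_delta]
  unfold U
  split
  · next h =>
    subst h
    simp only [if_true]
    rw [ENNReal.tsum_eq_iSup_nat' (tendsto_add_atTop_nat 1)]
    simp_rw [hsum]
  · next h =>
    rw [hsum, tsum_eq_sum (s := Finset.range (T.meetLevel ξ η + 1))]
    · refine Finset.sum_congr rfl fun k hk => ?_
      rw [if_pos ((le_meetLevel_iff h).1 (by simpa [Nat.lt_succ_iff] using hk))]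
    · intro k hk
      rw [if_neg]
      rw [← le_meetLevel_iff h]
      simpa [Nat.lt_succ_iff] using hk

lemma measurableSet_eq_apply (n : ℕ) :
    MeasurableSet {p : T.Boundary × T.Boundary | p.1 n = p.2 n} := by
  have := T.countable_sites
  have h : {p : T.Boundary × T.Boundary | p.1 n = p.2 n}
      = ⋃ j, ⋃ (_ : T.level j = n), T.cyl j ×ˢ T.cyl j := by
    ext p
    simp only [mem_iUnion, mem_prod, mem_cyl, exists_prop]
    constructor
    · intro (h : p.1 n = p.2 n)
      exact ⟨p.1 n, p.1.level n, by rw [p.1.level], by rw [p.1.level]; exact h.symm⟩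
    · rintro ⟨j, rfl, h1, h2⟩
      exact h1.trans h2.symm
  rw [h]
  exact .iUnion fun j => .iUnion fun _ => (measurableSet_cyl j).prod (measurableSet_cyl j)

lemma measurable_U : Measurable fun p : T.Boundary × T.Boundary => T.U p.1 p.2 := by
  classical
  simp_rw [U_eq_tsum]
  exact .tsum fun k =>
    Measurable.ite (measurableSet_eq_apply k) measurable_const measurable_const

lemma measurable_U_right (η : T.Boundary) : Measurable (T.U η) :=
  measurable_U.comp measurable_prodMk_left

/-- This is $W1=G_0=\alpha$. It makes $W$ of a bounded function absolutely convergent and $U$ finite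
almost everywhere, even if $w$ is unbounded. -/
lemma IsRegular.lintegral_U [IsFiniteMeasure T.exitMeasure] {η : T.Boundary} (h : IsRegular η) :
    ∫⁻ ξ, T.U η ξ ∂T.exitMeasure = ENNReal.ofReal T.alpha := by
  classical
  simp_rw [U_eq_tsum]
  have hs := h.hasSum 0
  simp only [zero_add] at hs
  rw [lintegral_tsum, ← pot_zero η, ← hs.tsum_eq, ENNReal.ofReal_tsum_of_nonneg _ hs.summable]
  · refine tsum_congr fun k => ?_
    have e : (fun ξ : T.Boundary => if η k = ξ k then ENNReal.ofReal (T.delta k) else 0)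
        = (T.C k η).indicator fun _ => ENNReal.ofReal (T.delta k) := by
      ext ξ
      simp [Set.indicator_apply, mem_C, eq_comm]
    rw [e, lintegral_indicator_const (measurableSet_C k η), ENNReal.ofReal_mul (T.delta_pos k).le,
      ofReal_measureReal]
  · exact fun k => mul_nonneg (T.delta_pos k).le measureReal_nonneg
  · intro k
    exact (Measurable.ite ((measurableSet_eq_apply k).preimage measurable_prodMk_left)
      measurable_const measurable_const).aemeasurable

lemma IsRegular.lintegral_U_mul_lt_top [IsFiniteMeasure T.exitMeasure] {η : T.Boundary}
    (h : IsRegular η) {g : T.Boundary → ℝ} {c : ℝ} (hc : ∀ ξ, |g ξ| ≤ c) :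
    ∫⁻ ξ, T.U η ξ * ‖g ξ‖ₑ ∂T.exitMeasure < ∞ := by
  calc ∫⁻ ξ, T.U η ξ * ‖g ξ‖ₑ ∂T.exitMeasure
      ≤ ∫⁻ ξ, T.U η ξ * ENNReal.ofReal c ∂T.exitMeasure := by
        refine lintegral_mono fun ξ => mul_le_mul_right ?_ _
        rw [Real.enorm_eq_ofReal_abs]
        exact ENNReal.ofReal_le_ofReal (hc ξ)
    _ = ENNReal.ofReal T.alpha * ENNReal.ofReal c := by
        rw [lintegral_mul_const _ (measurable_U_right η), h.lintegral_U]
    _ < ∞ := ENNReal.mul_lt_top ENNReal.ofReal_lt_top ENNReal.ofReal_lt_top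

lemma IsRegular.ae_U_lt_top [IsFiniteMeasure T.exitMeasure] {η : T.Boundary} (h : IsRegular η) :
    ∀ᵐ ξ ∂T.exitMeasure, T.U η ξ < ∞ :=
  ae_lt_top (measurable_U_right η) (by rw [h.lintegral_U]; exact ENNReal.ofReal_ne_top)

lemma integrable_U_mul {η : T.Boundary} {g : T.Boundary → ℝ}
    (hg : AEStronglyMeasurable g T.exitMeasure)
    (h : ∫⁻ ξ, T.U η ξ * ‖g ξ‖ₑ ∂T.exitMeasure < ∞) :
    Integrable (fun ξ => (T.U η ξ).toReal * g ξ) T.exitMeasure := by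
  refine ⟨(measurable_U_right η).ennreal_toReal.aestronglyMeasurable.mul hg, ?_⟩
  refine lt_of_le_of_lt (lintegral_mono fun ξ => ?_) h
  rw [enorm_mul]
  refine mul_le_mul_left ?_ _
  rw [Real.enorm_eq_ofReal ENNReal.toReal_nonneg]
  exact ENNReal.ofReal_toReal_le

/-- The expansion of `W g`. -/
lemma IsRegular.hasSum_W [IsFiniteMeasure T.exitMeasure] {η : T.Boundary} (h : IsRegular η)
    {g : T.Boundary → ℝ} (hg : Measurable g) {c : ℝ} (hc : ∀ ξ, |g ξ| ≤ c) :
    HasSum (fun k => T.delta k * ∫ ξ in T.C k η, g ξ ∂T.exitMeasure)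
      (∫ ξ, (T.U η ξ).toReal * g ξ ∂T.exitMeasure) := by
  classical
  have hgi : Integrable g T.exitMeasure := integrable_of_abs_le hg hc
  set F : ℕ → T.Boundary → ℝ := fun k ξ => T.delta k * (T.C k η).indicator g ξ with hF
  have hFi : ∀ k, Integrable (F k) T.exitMeasure := fun k =>
    (hgi.indicator (measurableSet_C k η)).const_mul _
  have hFint : ∀ k, ∫ ξ, F k ξ ∂T.exitMeasure = T.delta k * ∫ ξ in T.C k η, g ξ ∂T.exitMeasure :=
    fun k => by
      rw [hF]
      dsimp only
      rw [integral_const_mul, integral_indicator (measurableSet_C k η)]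
  have hs := h.hasSum 0
  simp only [zero_add] at hs
  have hsum : Summable fun k => ∫ ξ, ‖F k ξ‖ ∂T.exitMeasure := by
    refine Summable.of_nonneg_of_le (fun k => integral_nonneg fun ξ => norm_nonneg _) (fun k => ?_)
      (hs.summable.mul_right c)
    have e : ∀ ξ, ‖F k ξ‖ ≤ T.delta k * (T.C k η).indicator (fun _ => c) ξ := by
      intro ξ
      rw [hF]
      dsimp only
      rw [norm_mul, Real.norm_of_nonneg (T.delta_pos k).le]
      refine mul_le_mul_of_nonneg_left ?_ (T.delta_pos k).le
      simp only [Set.indicator_apply]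
      split
      · exact hc ξ
      · simp
    refine (integral_mono (hFi k).norm
      (((integrable_const c).indicator (measurableSet_C k η)).const_mul _) e).trans ?_
    rw [integral_const_mul, integral_indicator_const _ (measurableSet_C k η), smul_eq_mul,
      mul_assoc]
  have h1 := hasSum_integral_of_summable_integral_norm hFi hsum
  simp_rw [hFint] at h1
  suffices key : ∫ ξ, (T.U η ξ).toReal * g ξ ∂T.exitMeasure
      = ∫ ξ, ∑' k, F k ξ ∂T.exitMeasure by rw [key]; exact h1
  refine integral_congr_ae ?_
  filter_upwards [h.ae_U_lt_top] with ξ hξ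
  have h2 : (T.U η ξ).toReal = ∑' k, (if η k = ξ k then T.delta k else 0) := by
    rw [U_eq_tsum, ENNReal.tsum_toReal_eq]
    · refine tsum_congr fun k => ?_
      split
      · exact ENNReal.toReal_ofReal (T.delta_pos k).le
      · rfl
    · intro k
      split
      · exact ENNReal.ofReal_ne_top
      · simp
  rw [h2, ← tsum_mul_right]
  refine tsum_congr fun k => ?_
  simp only [hF, Set.indicator_apply, mem_C, eq_comm (a := ξ k), ite_mul, mul_ite, zero_mul,
    mul_zero]

variable (T)

/-! ### The inverse of `W` on simple functions -/

/-- The increment `1 / G_{k+1} - 1 / G_k`. -/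
def incr (k : ℕ) (η : T.Boundary) : ℝ := 1 / T.pot (k + 1) η - 1 / T.pot k η

/-- The inverse image under `W` of a function of the first `n` sites. -/
def preimageW (n : ℕ) (f : T.Boundary → ℝ) (η : T.Boundary) : ℝ :=
  1 / T.alpha * f η + ∑ k ∈ Finset.range n, T.incr k η * (f η - T.cond k f η)

variable {T}

lemma isLevel_incr (k : ℕ) : IsLevel k (T.incr k) := fun ξ η e => by
  unfold incr
  rw [pot_congr le_rfl e, pot_congr k.le_succ e]

lemma Transient.incr_nonneg (hT : T.Transient) (k : ℕ) (η : T.Boundary) : 0 ≤ T.incr k η :=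
  sub_nonneg.2 (one_div_le_one_div_of_le (hT.pot_pos _ _) (pot_antitone η k.le_succ))

lemma sum_incr (n : ℕ) (η : T.Boundary) :
    ∑ k ∈ Finset.range n, T.incr k η = 1 / T.pot n η - 1 / T.alpha := by
  unfold incr
  rw [Finset.sum_range_sub (fun k => 1 / T.pot k η), pot_zero]

lemma IsLevel.preimageW {n : ℕ} {f : T.Boundary → ℝ} (hf : IsLevel n f) :
    IsLevel n (T.preimageW n f) := fun ξ η e => by
  unfold TreeMatrix.preimageW
  rw [hf ξ η e]
  congr 1
  refine Finset.sum_congr rfl fun k hk => ?_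
  have hk' := (Finset.mem_range.1 hk).le
  rw [(isLevel_incr k).mono hk' ξ η e, (isLevel_cond k f).mono hk' ξ η e]

/-- On functions of the first $n$ sites with mean zero on all coarser cylinders, $W$ is
multiplication by $G_n$: levels below $n$ contribute nothing, and from level $n$ on the function is
constant on $C^k(\eta)$. -/
lemma IsRegular.integral_U_of_level [IsFiniteMeasure T.exitMeasure] {η : T.Boundary}
    (h : IsRegular η) {n : ℕ} {g : T.Boundary → ℝ} (hg : IsLevel n g)
    (h0 : ∀ k < n, ∫ ξ in T.C k η, g ξ ∂T.exitMeasure = 0) :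
    ∫ ξ, (T.U η ξ).toReal * g ξ ∂T.exitMeasure = T.pot n η * g η := by
  have h1 := h.hasSum_W hg.measurable hg.exists_bound.choose_spec
  rw [← hasSum_nat_add_iff' n, Finset.sum_eq_zero, sub_zero] at h1
  · have e : (fun k => T.delta (k + n) * ∫ ξ in T.C (k + n) η, g ξ ∂T.exitMeasure)
        = fun k => T.delta (n + k) * T.exitMeasure.real (T.C (n + k) η) * g η := by
      funext k
      rw [hg.setIntegral (Nat.le_add_left n k), add_comm k n]
      ring
    rw [e] at h1
    exact h1.unique ((h.hasSum n).mul_right (g η))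
  · intro k hk
    rw [h0 k (Finset.mem_range.1 hk), mul_zero]

lemma setIntegral_cond [IsFiniteMeasure T.exitMeasure] (n : ℕ) (f : T.Boundary → ℝ)
    (η : T.Boundary) :
    ∫ ξ in T.C n η, T.cond n f ξ ∂T.exitMeasure = ∫ ξ in T.C n η, f ξ ∂T.exitMeasure := by
  rw [(isLevel_cond n f).setIntegral le_rfl, cond]
  by_cases h : T.exitMeasure.real (T.C n η) = 0
  · rw [h, mul_zero, setIntegral_measure_zero _ ((measureReal_eq_zero_iff).1 h)]
  · field_simp

lemma setIntegral_sub_cond [IsFiniteMeasure T.exitMeasure] (n : ℕ) {f : T.Boundary → ℝ}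
    (hf : Integrable f T.exitMeasure) (η : T.Boundary) :
    ∫ ξ in T.C n η, (f ξ - T.cond n f ξ) ∂T.exitMeasure = 0 := by
  rw [integral_sub hf.integrableOn (isLevel_cond n f).integrable.integrableOn, setIntegral_cond,
    sub_self]

/-- The tower property. -/
lemma cond_cond [IsFiniteMeasure T.exitMeasure] {k n : ℕ} (hkn : k ≤ n) {f : T.Boundary → ℝ}
    (hf : Integrable f T.exitMeasure) : T.cond k (T.cond n f) = T.cond k f := by
  funext η
  have h := setIntegral_mul_eq_zero hkn (hf.sub (isLevel_cond n f).integrable)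
    (g := fun _ => (1 : ℝ)) (fun _ _ _ => rfl) (setIntegral_sub_cond n hf) η
  simp only [one_mul, Pi.sub_apply] at h
  rw [integral_sub hf.integrableOn (isLevel_cond n f).integrable.integrableOn, sub_eq_zero] at h
  rw [cond, cond, h]

/-- Induction on the level, splitting off the last martingale difference $f-E_nf$. Divided by
$G_{n+1}$ it still has mean zero on the cylinders of level at most $n$, so $W$ gives it back. -/
lemma Transient.integral_U_preimageW (hT : T.Transient) {n : ℕ} {f : T.Boundary → ℝ}
    (hf : IsLevel n f) {η : T.Boundary} (h : IsRegular η) :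
    ∫ ξ, (T.U η ξ).toReal * T.preimageW n f ξ ∂T.exitMeasure = f η := by
  have := hT.isProbabilityMeasure
  induction n generalizing f with
  | zero =>
    rw [h.integral_U_of_level hf.preimageW (by simp), pot_zero, preimageW]
    have := hT.alpha_pos.ne'
    simp
    field_simp
  | succ n ih =>
    have hfi := hf.integrable
    have hl := isLevel_cond n f
    have hd : IsLevel (n + 1) fun ξ => f ξ - T.cond n f ξ := fun ξ η e => by
      dsimp only
      rw [hf ξ η e, hl.mono n.le_succ ξ η e]
    have hp : IsLevel n fun ξ => 1 / T.pot (n + 1) ξ := fun ξ η e => by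
      dsimp only
      rw [pot_congr le_rfl e]
    have hg : IsLevel (n + 1) fun ξ => 1 / T.pot (n + 1) ξ * (f ξ - T.cond n f ξ) :=
      fun ξ η e => by
        have h1 := hp.mono n.le_succ ξ η e
        have h2 := hd ξ η e
        dsimp only at h1 h2 ⊢
        rw [h1, h2]
    have e1 := h.integral_U_of_level hg fun k hk => setIntegral_mul_eq_zero (by omega)
      hd.integrable hp (setIntegral_sub_cond n hfi) η
    -- Summation by parts: the coefficients of $f-E_nf$ are $1/\alpha$ and all increments up to
    -- level $n$, with total $1/G_{n+1}$; the tower property identifies the rest.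
    have e2 : ∀ ξ, T.preimageW (n + 1) f ξ = T.preimageW n (T.cond n f) ξ
        + 1 / T.pot (n + 1) ξ * (f ξ - T.cond n f ξ) := by
      intro ξ
      have e3 : 1 / T.pot (n + 1) ξ = 1 / T.alpha + ∑ k ∈ Finset.range (n + 1), T.incr k ξ := by
        rw [sum_incr]; ring
      rw [preimageW, preimageW, e3, Finset.sum_range_succ, Finset.sum_range_succ,
        ← add_assoc (1 / T.alpha), add_mul, add_mul, Finset.sum_mul]
      have e4 : ∑ k ∈ Finset.range n, T.incr k ξ * (f ξ - T.cond k f ξ)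
          = ∑ k ∈ Finset.range n, T.incr k ξ * (T.cond n f ξ - T.cond k (T.cond n f) ξ)
            + ∑ k ∈ Finset.range n, T.incr k ξ * (f ξ - T.cond n f ξ) := by
        rw [← Finset.sum_add_distrib]
        refine Finset.sum_congr rfl fun k hk => ?_
        rw [cond_cond (Finset.mem_range.1 hk).le hfi]
        ring
      rw [e4]
      ring
    simp_rw [e2, mul_add]
    have hi : ∀ {g : T.Boundary → ℝ} {m : ℕ}, IsLevel m g →
        Integrable (fun ξ => (T.U η ξ).toReal * g ξ) T.exitMeasure := fun hg =>
      integrable_U_mul hg.measurable.aestronglyMeasurable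
        (h.lintegral_U_mul_lt_top hg.exists_bound.choose_spec)
    rw [integral_add (hi hl.preimageW) (hi hg), ih hl, e1]
    have := (hT.pot_pos (n + 1) η).ne'
    field_simp
    ring

lemma F_le_comap (n : ℕ) :
    T.F n ≤ MeasurableSpace.comap (fun ξ : T.Boundary => ξ n) ⊤ := by
  refine MeasurableSpace.generateFrom_le ?_
  rintro _ ⟨η, rfl⟩
  exact ⟨{η n}, trivial, by ext ξ; simp [mem_C]⟩

/-- A simple function depends on finitely many sites, up to a null set. -/
lemma exists_isLevel {f : T.L2} (hf : f ∈ T.simpleFunctions) :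
    ∃ n f₀, IsLevel n f₀ ∧ f =ᵐ[T.exitMeasure] f₀ := by
  obtain ⟨n, hf⟩ := hf
  rw [mem_lpMeas_iff_aestronglyMeasurable] at hf
  refine ⟨n, hf.mk f, fun ξ η e => ?_, hf.ae_eq_mk⟩
  have h1 : MeasurableSet[T.F n] {ζ | hf.mk f ζ = hf.mk f η} :=
    hf.stronglyMeasurable_mk.measurable (measurableSet_singleton _)
  obtain ⟨t, -, ht⟩ := F_le_comap n _ h1
  have h2 : η ∈ {ζ | hf.mk f ζ = hf.mk f η} := rfl
  have h3 : ξ ∈ {ζ | hf.mk f ζ = hf.mk f η} := by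
    rw [← ht] at h2 ⊢
    change ξ.1 n ∈ t
    rw [e]
    exact h2
  exact h3

lemma Transient.wEq_of_isLevel (hT : T.Transient) {n : ℕ} {f₀ : T.Boundary → ℝ}
    (hf₀ : IsLevel n f₀) {f h : T.L2} (hf : f =ᵐ[T.exitMeasure] f₀)
    (hh : h =ᵐ[T.exitMeasure] T.preimageW n f₀) : T.WEq h f := by
  have := hT.isProbabilityMeasure
  filter_upwards [ae_isRegular, hf] with η hη hfη
  constructor
  · rw [lintegral_congr_ae (g := fun ξ => T.U η ξ * ‖T.preimageW n f₀ ξ‖ₑ)]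
    · exact hη.lintegral_U_mul_lt_top hf₀.preimageW.exists_bound.choose_spec
    · filter_upwards [hh] with ξ hξ
      rw [hξ]
  · rw [integral_congr_ae (g := fun ξ => (T.U η ξ).toReal * T.preimageW n f₀ ξ), hfη]
    · exact hT.integral_U_preimageW hf₀ hη
    · filter_upwards [hh] with ξ hξ
      rw [hξ]

lemma Transient.exists_wEq (hT : T.Transient) {n : ℕ} {f₀ : T.Boundary → ℝ}
    (hf₀ : IsLevel n f₀) {f : T.L2} (hf : f =ᵐ[T.exitMeasure] f₀) :
    ∃ h : T.L2, T.WEq h f ∧ h =ᵐ[T.exitMeasure] T.preimageW n f₀ := by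
  have := hT.isProbabilityMeasure
  have hl := hf₀.preimageW
  obtain ⟨c, hc⟩ := hl.exists_bound
  have hm : MemLp (T.preimageW n f₀) 2 T.exitMeasure :=
    MemLp.of_bound hl.measurable.aestronglyMeasurable c (.of_forall hc)
  exact ⟨hm.toLp, hT.wEq_of_isLevel hf₀ hf hm.coeFn_toLp, hm.coeFn_toLp⟩

/-! ### Injectivity of `W` -/

/-- Two cylinders with a common point are nested. -/
lemma isPiSystem_cyl : IsPiSystem (Set.range T.cyl) := by
  rintro _ ⟨i, rfl⟩ _ ⟨j, rfl⟩ ⟨ξ, hi, hj⟩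
  rw [mem_cyl] at hi hj
  have key : ∀ {i j : I}, ξ (T.level i) = i → ξ (T.level j) = j → T.level i ≤ T.level j →
      T.cyl j ⊆ T.cyl i := by
    intro i j hi hj hij η hη
    rw [mem_cyl] at hη ⊢
    rw [Boundary.eq_of_le hij (hη.trans hj.symm), hi]
  rcases le_total (T.level i) (T.level j) with h | h
  · exact ⟨j, (inter_eq_right.2 (key hi hj h)).symm⟩
  · exact ⟨i, (inter_eq_left.2 (key hj hi h)).symm⟩

lemma ae_eq_zero_of_setIntegral_cyl {d : T.Boundary → ℝ}
    (hd : Integrable d T.exitMeasure) (h : ∀ j, ∫ ξ in T.cyl j, d ξ ∂T.exitMeasure = 0) :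
    d =ᵐ[T.exitMeasure] 0 := by
  have huniv : T.cyl T.root = univ := by
    refine eq_univ_of_forall fun η => ?_
    rw [mem_cyl, level_root, η.2.1]
  have key : ∀ s, MeasurableSet s → ∫ ξ in s, d ξ ∂T.exitMeasure = 0 := by
    intro s hs
    induction s, hs using MeasurableSpace.induction_on_inter rfl isPiSystem_cyl with
    | empty => simp
    | basic t ht => obtain ⟨j, rfl⟩ := ht; exact h j
    | compl t ht ih => rw [setIntegral_compl ht hd, ih, sub_zero, ← setIntegral_univ, ← huniv, h]
    | iUnion f hdisj hf ih =>
      rw [integral_iUnion hf hdisj hd.integrableOn]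
      simp [ih]
  exact hd.ae_eq_zero_of_forall_setIntegral_eq_zero fun s hs _ => key s hs

/-- `W` is one-to-one. -/
lemma Transient.wEq_unique (hT : T.Transient) {h h' f : T.L2} (hh : T.WEq h f)
    (hh' : T.WEq h' f) : h = h' := by
  have := hT.isProbabilityMeasure
  have hi : Integrable h T.exitMeasure := (Lp.memLp h).integrable (by norm_num)
  have hi' : Integrable h' T.exitMeasure := (Lp.memLp h').integrable (by norm_num)
  set d : T.Boundary → ℝ := fun ξ => h ξ - h' ξ with hd
  have hdi : Integrable d T.exitMeasure := hi.sub hi'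
  have hW : ∀ᵐ η ∂T.exitMeasure, ∫ ξ, (T.U η ξ).toReal * d ξ ∂T.exitMeasure = 0 := by
    filter_upwards [hh, hh'] with η h1 h2
    simp_rw [hd, mul_sub]
    rw [integral_sub (integrable_U_mul hi.aestronglyMeasurable h1.1)
      (integrable_U_mul hi'.aestronglyMeasurable h2.1), h1.2, h2.2, sub_self]
  have hd0 : d =ᵐ[T.exitMeasure] 0 := by
    refine ae_eq_zero_of_setIntegral_cyl hdi fun j => ?_
    set f₀ : T.Boundary → ℝ := (T.cyl j).indicator fun _ => 1 with hf₀def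
    have hf₀ : IsLevel (T.level j) f₀ := fun ξ η e => by
      classical
      simp only [hf₀def, Set.indicator_apply, mem_cyl, e]
    set g := T.preimageW (T.level j) f₀ with hg
    obtain ⟨c, hc⟩ := hf₀.preimageW.exists_bound
    have hgm : Measurable g := hf₀.preimageW.measurable
    have hUm : Measurable fun p : T.Boundary × T.Boundary => (T.U p.1 p.2).toReal :=
      measurable_U.ennreal_toReal
    -- Integrability for Fubini: $|g|\le c$ and $\int U\,d\mu=\alpha$ bound the inner integral by
    -- $\alpha c|d|$.
    have hprod : Integrable (fun p : T.Boundary × T.Boundary =>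
        (T.U p.1 p.2).toReal * g p.2 * d p.1) (T.exitMeasure.prod T.exitMeasure) := by
      have hm : AEStronglyMeasurable (fun p : T.Boundary × T.Boundary =>
          (T.U p.1 p.2).toReal * g p.2 * d p.1) (T.exitMeasure.prod T.exitMeasure) :=
        ((hUm.mul (hgm.comp measurable_snd)).aestronglyMeasurable).mul
          hdi.aestronglyMeasurable.comp_fst
      rw [integrable_prod_iff hm]
      constructor
      · filter_upwards [ae_isRegular] with η hη
        exact (integrable_U_mul hgm.aestronglyMeasurable
          (hη.lintegral_U_mul_lt_top hc)).mul_const _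
      · refine Integrable.mono' (hdi.norm.const_mul (T.alpha * c))
          hm.norm.integral_prod_right' ?_
        filter_upwards [ae_isRegular] with η hη
        have hU : Integrable (fun ξ => (T.U η ξ).toReal) T.exitMeasure :=
          integrable_toReal_of_lintegral_ne_top (measurable_U_right η).aemeasurable
            (by rw [hη.lintegral_U]; exact ENNReal.ofReal_ne_top)
        have hUi : ∫ ξ, (T.U η ξ).toReal ∂T.exitMeasure = T.alpha := by
          rw [integral_toReal (measurable_U_right η).aemeasurable hη.ae_U_lt_top, hη.lintegral_U,
            ENNReal.toReal_ofReal hT.alpha_pos.le]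
        rw [Real.norm_of_nonneg (integral_nonneg fun ξ => norm_nonneg _)]
        simp_rw [norm_mul, Real.norm_of_nonneg ENNReal.toReal_nonneg]
        rw [integral_mul_const]
        refine mul_le_mul_of_nonneg_right ?_ (norm_nonneg _)
        rw [← hUi, ← integral_mul_const]
        refine integral_mono ?_ (hU.mul_const c) fun ξ =>
          mul_le_mul_of_nonneg_left (hc ξ) ENNReal.toReal_nonneg
        have := (integrable_U_mul hgm.aestronglyMeasurable (hη.lintegral_U_mul_lt_top hc)).norm
        simpa [norm_mul, Real.norm_of_nonneg ENNReal.toReal_nonneg] using this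
    -- Duality: $\langle\mathbf 1_{C_j},d\rangle=\langle Wg,d\rangle=\langle g,Wd\rangle=0$.
    calc ∫ η in T.cyl j, d η ∂T.exitMeasure = ∫ η, f₀ η * d η ∂T.exitMeasure := by
          rw [← integral_indicator (measurableSet_cyl j)]
          refine integral_congr_ae (.of_forall fun η => ?_)
          by_cases hη : η ∈ T.cyl j <;> simp [hf₀def, hη]
      _ = ∫ η, ∫ ξ, (T.U η ξ).toReal * g ξ * d η ∂T.exitMeasure ∂T.exitMeasure := by
          refine integral_congr_ae ?_
          filter_upwards [ae_isRegular] with η hη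
          rw [integral_mul_const, hT.integral_U_preimageW hf₀ hη]
      _ = ∫ ξ, ∫ η, (T.U η ξ).toReal * g ξ * d η ∂T.exitMeasure ∂T.exitMeasure :=
          integral_integral_swap hprod
      _ = ∫ ξ, (0 : ℝ) ∂T.exitMeasure := by
          refine integral_congr_ae ?_
          filter_upwards [hW] with ξ hξ
          have e : ∀ η, (T.U η ξ).toReal * g ξ * d η = g ξ * ((T.U ξ η).toReal * d η) := by
            intro η; rw [U_comm]; ring
          simp_rw [e]
          rw [integral_const_mul, hξ, mul_zero]
      _ = 0 := integral_zero _ _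
  refine Lp.ext ?_
  filter_upwards [hd0] with ξ hξ
  exact sub_eq_zero.1 hξ

lemma Transient.wInv_ae_eq (hT : T.Transient) {n : ℕ} {f₀ : T.Boundary → ℝ}
    (hf₀ : IsLevel n f₀) {f : T.L2} (hf : f =ᵐ[T.exitMeasure] f₀) :
    T.WInv f =ᵐ[T.exitMeasure] T.preimageW n f₀ := by
  obtain ⟨h, hW, hh⟩ := hT.exists_wEq hf₀ hf
  have hex : ∃ h, T.WEq h f := ⟨h, hW⟩
  have e : T.WInv f = h := by
    rw [WInv, dif_pos hex]
    exact hT.wEq_unique hex.choose_spec hW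
  rw [e]
  exact hh

variable (T)

/-! ### The jump density -/

open Classical in
/-- The part of the jump density that belongs to the sites of level `k`. -/
def jumpTerm (k : ℕ) (p : T.Boundary × T.Boundary) : ℝ :=
  if p.1 k = p.2 k then (T.exitMeasure.real (T.C k p.1))⁻¹ * T.incr k p.1 else 0

variable {T}

/-- `F(η, ξ)` only depends on `η(n)` and `ξ(n)`. -/
def IsPairLevel (n : ℕ) (F : T.Boundary × T.Boundary → ℝ) : Prop :=
  ∀ p q : T.Boundary × T.Boundary, p.1 n = q.1 n → p.2 n = q.2 n → F p = F q

lemma IsPairLevel.integrable [IsFiniteMeasure T.exitMeasure] {n : ℕ}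
    {F : T.Boundary × T.Boundary → ℝ} (h : IsPairLevel n F) :
    Integrable F (T.exitMeasure.prod T.exitMeasure) := by
  let e : T.Boundary × T.Boundary → I × I := fun p => (p.1 n, p.2 n)
  have h1 : Function.FactorsThrough F e := fun p q he =>
    h p q (congrArg Prod.fst he) (congrArg Prod.snd he)
  have h2 : F = fun p => Function.extend e F 0 (e p) := funext fun p => (h1.extend_apply 0 p).symm
  have hm : Measurable F := by
    let : MeasurableSpace I := ⊤
    have : MeasurableSingletonClass I := ⟨fun _ => trivial⟩
    have := T.countable_sites
    have he : Measurable e :=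
      ((measurable_comp_apply id n).comp measurable_fst).prodMk
        ((measurable_comp_apply id n).comp measurable_snd)
    rw [h2]
    exact (measurable_of_countable (Function.extend e F 0)).comp he
  refine integrable_of_abs_le hm (c := ∑ x ∈ T.sites n ×ˢ T.sites n, |Function.extend e F 0 x|)
    fun p => ?_
  rw [congrFun h2 p]
  exact Finset.single_le_sum (f := fun x => |Function.extend e F 0 x|) (fun x _ => abs_nonneg _)
    (Finset.mem_product.2 ⟨mem_sites.2 (p.1.level n), mem_sites.2 (p.2.level n)⟩)

lemma isPairLevel_jumpTerm {k n : ℕ} (hkn : k ≤ n) : IsPairLevel n (T.jumpTerm k) := by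
  intro p q h1 h2
  have h1' := Boundary.eq_of_le hkn h1
  have h2' := Boundary.eq_of_le hkn h2
  unfold jumpTerm C
  rw [h1', h2', isLevel_incr k p.1 q.1 h1']

lemma jumpTerm_swap (k : ℕ) (p : T.Boundary × T.Boundary) :
    T.jumpTerm k p.swap = T.jumpTerm k p := by
  unfold jumpTerm
  by_cases h : p.1 k = p.2 k
  · rw [if_pos h, if_pos (show p.swap.1 k = p.swap.2 k from h.symm), C_eq h.symm,
      isLevel_incr k p.1 p.2 h]
    rfl
  · rw [if_neg h, if_neg (show ¬ p.swap.1 k = p.swap.2 k from Ne.symm h)]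

lemma Transient.jumpTerm_nonneg (hT : T.Transient) (k : ℕ) (p : T.Boundary × T.Boundary) :
    0 ≤ T.jumpTerm k p := by
  unfold jumpTerm
  split
  · exact mul_nonneg (inv_nonneg.2 measureReal_nonneg) (hT.incr_nonneg k _)
  · exact le_rfl

lemma IsRegular.H_eq {η : T.Boundary} (h : IsRegular η) (ξ : T.Boundary) :
    T.H η ξ = ∑' k, T.jumpTerm k (η, ξ) := by
  classical
  refine tsum_congr fun n => ?_
  -- Among the sites of level $n$ only $\eta(n)$ has $\eta$ in its cylinder.
  rw [tsum_eq_single ⟨η n, η.level n⟩]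
  · simp only [h.G_eq, Set.indicator_apply, mem_prod, mem_cyl, η.level, jumpTerm, C, incr,
      true_and, one_div, mul_ite, mul_one, mul_zero, eq_comm (a := ξ.1 n)]
  · rintro ⟨j, rfl⟩ hj
    rw [indicator_of_notMem, mul_zero]
    rintro ⟨h1, -⟩
    rw [mem_cyl] at h1
    exact hj (Subtype.ext h1.symm)

/-- Either $f(\eta)=f(\xi)$, or $\eta(n)\ne\xi(n)$ and no level $k\ge n$ contributes to $H$.
Convergence of $H$ on the diagonal is therefore irrelevant. -/
lemma IsRegular.mul_H_eq {n : ℕ} {f g : T.Boundary → ℝ} (hf : IsLevel n f)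
    {p : T.Boundary × T.Boundary} (h : IsRegular p.1) :
    (f p.1 - f p.2) * (g p.1 - g p.2) * T.H p.1 p.2
      = ∑ k ∈ Finset.range n, (f p.1 - f p.2) * (g p.1 - g p.2) * T.jumpTerm k p := by
  rw [← Finset.mul_sum, h.H_eq]
  by_cases hn : p.1 n = p.2 n
  · rw [hf _ _ hn]; simp
  · congr 1
    refine tsum_eq_sum fun k hk => ?_
    unfold jumpTerm
    rw [if_neg]
    exact fun e => hn (Boundary.eq_of_le (by simpa using hk) e)

/-- Integration over $\xi$ turns the jump kernel of level $k$ into the operator $1-E_k$, weighted by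
the increment. -/
lemma integral_mul_jumpTerm [IsFiniteMeasure T.exitMeasure] {f : T.Boundary → ℝ}
    (hf : Integrable f T.exitMeasure) {η : T.Boundary} (k : ℕ)
    (h : T.exitMeasure.real (T.C k η) ≠ 0) :
    ∫ ξ, (f η - f ξ) * T.jumpTerm k (η, ξ) ∂T.exitMeasure
      = T.incr k η * (f η - T.cond k f η) := by
  classical
  have e : ∀ ξ, (f η - f ξ) * T.jumpTerm k (η, ξ) = (T.C k η).indicator (fun ξ =>
      (T.exitMeasure.real (T.C k η))⁻¹ * T.incr k η * (f η - f ξ)) ξ := by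
    intro ξ
    simp only [jumpTerm, Set.indicator_apply, mem_C, eq_comm (a := ξ.1 k)]
    split
    · ring
    · ring
  simp_rw [e]
  rw [integral_indicator (measurableSet_C k η), integral_const_mul,
    integral_sub (integrable_const _).integrableOn hf.integrableOn, setIntegral_const, cond,
    smul_eq_mul]
  field_simp

/-- Symmetrization of the level `k` part of the form. -/
lemma integral_jumpTerm [IsFiniteMeasure T.exitMeasure] {k n : ℕ} (hkn : k ≤ n)
    {f g : T.Boundary → ℝ} (hf : IsLevel n f) (hg : IsLevel n g) :
    ∫ p, (f p.1 - f p.2) * (g p.1 - g p.2) * T.jumpTerm k p ∂(T.exitMeasure.prod T.exitMeasure)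
      = 2 * ∫ η, g η * (T.incr k η * (f η - T.cond k f η)) ∂T.exitMeasure := by
  -- Expanding $g(\eta)-g(\xi)$ gives two terms exchanged by the swap of coordinates, because the
  -- kernel is symmetric; hence the factor 2.
  set A : T.Boundary × T.Boundary → ℝ := fun p => g p.1 * ((f p.1 - f p.2) * T.jumpTerm k p)
    with hA
  have hAl : IsPairLevel n A := fun p q h1 h2 => by
    simp only [hA]
    rw [hf _ _ h1, hf _ _ h2, hg _ _ h1, isPairLevel_jumpTerm hkn p q h1 h2]
  have hAi := hAl.integrable
  have hsplit : ∀ p : T.Boundary × T.Boundary,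
      (f p.1 - f p.2) * (g p.1 - g p.2) * T.jumpTerm k p = A p + A p.swap := by
    intro p
    simp only [hA, jumpTerm_swap, Prod.fst_swap, Prod.snd_swap]
    ring
  simp_rw [hsplit]
  have hswap : Integrable (fun p => A p.swap) (T.exitMeasure.prod T.exitMeasure) := hAi.swap
  rw [integral_add hAi hswap, integral_prod_swap, ← two_mul, integral_prod _ hAi]
  congr 1
  refine integral_congr_ae ?_
  filter_upwards [ae_exitMeasure_C_ne_zero] with η hη
  simp only [hA]
  rw [integral_const_mul, integral_mul_jumpTerm hf.integrable k (hη k)]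

/-- The Beurling–Deny formula for functions of the first `n` sites. -/
lemma Transient.beurlingDeny (hT : T.Transient) {n : ℕ} {f g : T.Boundary → ℝ}
    (hf : IsLevel n f) (hg : IsLevel n g) :
    Integrable (fun p : T.Boundary × T.Boundary =>
        (f p.1 - f p.2) * (g p.1 - g p.2) * T.H p.1 p.2) (T.exitMeasure.prod T.exitMeasure) ∧
      ∫ η, g η * T.preimageW n f η ∂T.exitMeasure =
        1 / 2 * ∫ p, (f p.1 - f p.2) * (g p.1 - g p.2) * T.H p.1 p.2
            ∂(T.exitMeasure.prod T.exitMeasure)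
          + 1 / T.alpha * ∫ η, f η * g η ∂T.exitMeasure := by
  have := hT.isProbabilityMeasure
  have hreg : ∀ᵐ p ∂(T.exitMeasure.prod T.exitMeasure), IsRegular p.1 :=
    Measure.quasiMeasurePreserving_fst.ae ae_isRegular
  have hH : (fun p : T.Boundary × T.Boundary =>
      (f p.1 - f p.2) * (g p.1 - g p.2) * T.H p.1 p.2) =ᵐ[T.exitMeasure.prod T.exitMeasure]
        fun p => ∑ k ∈ Finset.range n, (f p.1 - f p.2) * (g p.1 - g p.2) * T.jumpTerm k p := by
    filter_upwards [hreg] with p hp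
    exact hp.mul_H_eq hf
  have hi : ∀ k ∈ Finset.range n, Integrable (fun p : T.Boundary × T.Boundary =>
      (f p.1 - f p.2) * (g p.1 - g p.2) * T.jumpTerm k p) (T.exitMeasure.prod T.exitMeasure) := by
    intro k hk
    refine IsPairLevel.integrable (n := n) fun p q h1 h2 => ?_
    rw [hf _ _ h1, hf _ _ h2, hg _ _ h1, hg _ _ h2,
      isPairLevel_jumpTerm (Finset.mem_range.1 hk).le p q h1 h2]
  refine ⟨(integrable_finsetSum _ hi).congr hH.symm, ?_⟩
  rw [integral_congr_ae hH, integral_finsetSum _ hi, Finset.sum_congr rfl fun k hk =>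
    integral_jumpTerm (Finset.mem_range.1 hk).le hf hg, ← Finset.mul_sum, ← mul_assoc,
    one_div_mul_cancel two_ne_zero, one_mul]
  have hi' : ∀ k ∈ Finset.range n,
      Integrable (fun η => g η * (T.incr k η * (f η - T.cond k f η))) T.exitMeasure := by
    intro k hk
    refine IsLevel.integrable (n := n) fun ξ η e => ?_
    have hk' := (Finset.mem_range.1 hk).le
    rw [hf ξ η e, hg ξ η e, (isLevel_incr k).mono hk' ξ η e, (isLevel_cond k f).mono hk' ξ η e]
  have hfg : Integrable (fun η => f η * g η) T.exitMeasure :=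
    IsLevel.integrable (n := n) fun ξ η e => by
      rw [hf ξ η e, hg ξ η e]
  rw [← integral_finsetSum _ hi', ← integral_const_mul,
    ← integral_add (integrable_finsetSum _ hi') (hfg.const_mul _)]
  congr with η
  rw [preimageW, mul_add, Finset.mul_sum]
  ring

end

end TreeMatrix

/-! ### Assembly of the proposition. -/

theorem mainTheorem11 {I : Type*} (T : TreeMatrix I) (hT : T.Transient) :
    -- `μ` is a probability measure, the `G_n` are positive and `G_0` is constant
    IsProbabilityMeasure T.exitMeasure ∧
    0 < T.alpha ∧
    (∀ᵐ η ∂T.exitMeasure, T.G 0 η = T.alpha ∧ ∀ n, 0 < T.G n η) ∧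
    -- `W` is one-to-one and its range contains the simple functions
    (∀ h h' f : T.L2, T.WEq h f → T.WEq h' f → h = h') ∧
    (∀ f ∈ T.simpleFunctions, ∃ h : T.L2, T.WEq h f) ∧
    -- `H` is symmetric and nonnegative off the diagonal
    (∀ᵐ p ∂(T.exitMeasure.prod T.exitMeasure), p.1 ≠ p.2 →
      0 ≤ T.H p.1 p.2 ∧ T.H p.1 p.2 = T.H p.2 p.1) ∧
    -- the Beurling–Deny formula
    ∀ f ∈ T.simpleFunctions, ∀ g ∈ T.simpleFunctions,
      IntegrableOn (fun p : T.Boundary × T.Boundary =>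
          (f p.1 - f p.2) * (g p.1 - g p.2) * T.H p.1 p.2)
        {p | p.1 ≠ p.2} (T.exitMeasure.prod T.exitMeasure) ∧
      T.dirichletForm f g =
        1 / 2 * ∫ p in {p : T.Boundary × T.Boundary | p.1 ≠ p.2},
            (f p.1 - f p.2) * (g p.1 - g p.2) * T.H p.1 p.2
              ∂(T.exitMeasure.prod T.exitMeasure)
          + 1 / T.alpha * ∫ η, f η * g η ∂T.exitMeasure := by
  have := hT.isProbabilityMeasure
  refine ⟨this, hT.alpha_pos, ?_, fun h h' f hh hh' => hT.wEq_unique hh hh', ?_, ?_, ?_⟩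
  · filter_upwards [TreeMatrix.ae_isRegular] with η hη
    refine ⟨by rw [hη.G_eq, TreeMatrix.pot_zero], fun n => ?_⟩
    rw [hη.G_eq]
    exact hT.pot_pos n η
  · intro f hf
    obtain ⟨n, f₀, hf₀, he⟩ := TreeMatrix.exists_isLevel hf
    obtain ⟨h, hh, -⟩ := hT.exists_wEq hf₀ he
    exact ⟨h, hh⟩
  · have h1 : ∀ᵐ p ∂(T.exitMeasure.prod T.exitMeasure), TreeMatrix.IsRegular p.1 :=
      Measure.quasiMeasurePreserving_fst.ae TreeMatrix.ae_isRegular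
    have h2 : ∀ᵐ p ∂(T.exitMeasure.prod T.exitMeasure), TreeMatrix.IsRegular p.2 :=
      Measure.quasiMeasurePreserving_snd.ae TreeMatrix.ae_isRegular
    filter_upwards [h1, h2] with p hp1 hp2 _
    rw [hp1.H_eq, hp2.H_eq]
    exact ⟨tsum_nonneg fun k => hT.jumpTerm_nonneg k p,
      tsum_congr fun k => (TreeMatrix.jumpTerm_swap k p).symm⟩
  · intro f hf g hg
    obtain ⟨n, f₀, hf₀, hfe⟩ := TreeMatrix.exists_isLevel hf
    obtain ⟨m, g₀, hg₀, hge⟩ := TreeMatrix.exists_isLevel hg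
    -- Both functions are regarded as functions of the first `max n m` sites.
    have hf₁ := hf₀.mono (le_max_left n m)
    have hg₁ := hg₀.mono (le_max_right n m)
    obtain ⟨hint, hform⟩ := hT.beurlingDeny hf₁ hg₁
    have hH : (fun p : T.Boundary × T.Boundary =>
        (f p.1 - f p.2) * (g p.1 - g p.2) * T.H p.1 p.2) =ᵐ[T.exitMeasure.prod T.exitMeasure]
          fun p => (f₀ p.1 - f₀ p.2) * (g₀ p.1 - g₀ p.2) * T.H p.1 p.2 := by
      filter_upwards [Measure.quasiMeasurePreserving_fst.ae hfe,
        Measure.quasiMeasurePreserving_snd.ae hfe, Measure.quasiMeasurePreserving_fst.ae hge,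
        Measure.quasiMeasurePreserving_snd.ae hge] with p h1 h2 h3 h4
      rw [h1, h2, h3, h4]
    -- The integrand vanishes on the diagonal, so removing it costs nothing even if $\mu$ has atoms.
    have hoff : ∫ p in {p : T.Boundary × T.Boundary | p.1 ≠ p.2},
        (f p.1 - f p.2) * (g p.1 - g p.2) * T.H p.1 p.2 ∂(T.exitMeasure.prod T.exitMeasure)
        = ∫ p, (f p.1 - f p.2) * (g p.1 - g p.2) * T.H p.1 p.2
          ∂(T.exitMeasure.prod T.exitMeasure) := by
      refine setIntegral_eq_integral_of_forall_compl_eq_zero fun p hp => ?_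
      have e : p.1 = p.2 := not_not.1 hp
      rw [e]
      simp
    refine ⟨(hint.congr hH.symm).integrableOn, ?_⟩
    rw [hoff, integral_congr_ae hH]
    refine Eq.trans (integral_congr_ae ?_) (hform.trans (congrArg₂ (· + ·) rfl
      (congrArg (1 / T.alpha * ·) (integral_congr_ae ?_))))
    · filter_upwards [hT.wInv_ae_eq hf₁ hfe, hge] with η h1 h2
      rw [h1, h2]
    · filter_upwards [hfe, hge] with η h1 h2
      rw [h1, h2]
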